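/- Fix $n\ge 1$ and work over $\mathbf{C}$; $\mathrm{Vec}$ is the category of finite dimensional vector spaces. Let $\mathrm{Flag}_n$ be the category of finite dimensional vector spaces $V$ with a flag $0=V_0\subseteq V_1\subseteq\cdots\subseteq V_n=V$; morphisms are the linear maps $f$ with $f(V_i)\subseteq W_i$ for all $i$. Let $\mathscr{A}$ be the category of polynomial functors $\mathrm{Flag}_n\to\mathrm{Vec}$, i.e. of subquotients of finite direct sums of the functors $\{V_i\}\mapsto V^{\otimes a}$ ($a\ge 0$), with the pointwise tensor product. Let $\mathbf{V}$ be the vector space with basis $e_{i,m}$ ($1\le i\le n$, $m\ge 1$), let $\mathbf{V}_i$ be the span of the $e_{k,m}$ with $k\le i$, and let $\mathbf{G}$ be the group of automorphisms of $\mathbf{V}$ that preserve this flag and that, for some $j$, preserve the span of the $e_{i,m}$ with $m\le j$ and fix all other basis vectors. Let $\mathrm{Rep}(\mathbf{G})$ be the category of polynomial representations of $\mathbf{G}$, i.e. of subquotients of finite direct sums of tensor powers of $\mathbf{V}$, with the usual tensor product. Both categories are tensor categories ($\mathbf{C}$-linear and symmetric monoidal). For $\underline{a}\in\mathbf{N}^n$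 let $\mathbf{C}^{\underline{a}}\subset\mathbf{V}$ be the span of the $e_{i,m}$ with $m\le a_i$, with the induced flag, and let $H_{\underline{a}}\subset\mathbf{G}$ be the subgroup of the block diagonal matrices whose $(i,i)$ block is of the form $\begin{pmatrix}1&0\\0&*\end{pmatrix}$ with top left block of size $a_i\times a_i$. On a polynomial representation $V$ the action of $\mathbf{G}$ extends uniquely to an action, polynomial in the matrix entries, of the monoid of those flag preserving endomorphisms of $\mathbf{V}$ that, for some $j$, preserve the span of the $e_{i,m}$ with $m\le j$ and fix all other basis vectors. For a morphism $f:\mathbf{C}^{\underline{a}}\to\mathbf{C}^{\underline{b}}$ in $\mathrm{Flag}_n$, any element $g_f$ of this monoid that extends $f$ maps $V^{H_{\underline{a}}}$ to $V^{H_{\underline{b}}}$, and the resulting map does not depend on the choice of $g_f$. So $\underline{a}\mapsto V^{H_{\underline{a}}}$ is a functor on the full subcategory of $\mathrm{Flag}_n$ on the flags $\mathbf{C}^{\underline{a}}$. **Proposition.** (1) For $F\in\mathscr{A}$ the direct limit $\Phi(F)=\varinjlim_j F(\mathbf{C}^{(j^n)})$, where $(j^n)=(j,\dots,j)$, with its natural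 action of $\mathbf{G}$, is a polynomial representation; this defines a functor $\Phi:\mathscr{A}\to\mathrm{Rep}(\mathbf{G})$. (2) There is a functor $\Psi:\mathrm{Rep}(\mathbf{G})\to\mathscr{A}$ with $\Psi(V)(\mathbf{C}^{\underline{a}})=V^{H_{\underline{a}}}$, naturally in $V$ and in $\mathbf{C}^{\underline{a}}$ (with the functoriality in $\mathbf{C}^{\underline{a}}$ just described). (3) $\Phi$ and $\Psi$ are $\mathbf{C}$-linear symmetric monoidal functors, with the canonical structures: those induced by $(x,y)\mapsto x\otimes y$ on $F(\mathbf{C}^{(j^n)})\times F'(\mathbf{C}^{(j^n)})$ and on $V^{H_{\underline{a}}}\times W^{H_{\underline{a}}}$ respectively. (4) $\Phi$ is left adjoint to $\Psi$ by a monoidal adjunction whose unit and counit are isomorphisms, and whose counit $\Phi\Psi(V)=\varinjlim_j V^{H_{(j^n)}}\to V$ is induced by the inclusions $V^{H_{(j^n)}}\subseteq V$. In particular $\Phi$ and $\Psi$ are mutually inverse equivalences of tensor categories $\mathscr{A}\cong\mathrm{Rep}(\mathbf{G})$. -/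

import Mathlib

open CategoryTheory MonoidalCategory

namespace FlagSchur

noncomputable section

/-! ### Tensor powers, subquotients and polynomial objects in a monoidal category -/

section General

open CategoryTheory.Limits

universe v u

variable {C : Type u} [Category.{v} C] [MonoidalCategory C]

/-- The tensor power `T ⊗ ⋯ ⊗ T` with `k` factors. -/
def tensorPow (T : C) : ℕ → C
  | 0 => 𝟙_ C
  | k + 1 => tensorPow T k ⊗ T

/-- `X` is a subquotient of `Y`: a quotient of a subobject of `Y`. -/
def IsSubquotient (X Y : C) : Prop :=
  ∃ (Z : C) (i : Z ⟶ Y) (q : Z ⟶ X), Mono i ∧ Epi q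

/-- The canonical isomorphism `T^{⊗a} ⊗ T^{⊗b} ≅ T^{⊗(a+b)}`. -/
def tensorPowAdd (T : C) (a : ℕ) :
    (b : ℕ) → (tensorPow T a ⊗ tensorPow T b ≅ tensorPow T (a + b))
  | 0 => ρ_ _
  | b + 1 => (α_ _ _ _).symm ≪≫ whiskerRightIso (tensorPowAdd T a b) T

variable [Preadditive C] [HasFiniteBiproducts C]

/-- The objects that are subquotients of a finite direct sum of tensor powers of `T`. -/
def isPolynomial (T : C) : ObjectProperty C := fun X =>
  ∃ (k : ℕ) (a : Fin k → ℕ), IsSubquotient X (⨁ fun i => tensorPow T (a i))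

/-- If tensoring is exact, then the polynomial objects contain the unit and are closed under the
tensor product. -/
theorem isPolynomial_isMonoidal [MonoidalPreadditive C]
    (hm : ∀ (X : C) {Y Z : C} (f : Y ⟶ Z), Mono f → Mono (X ◁ f))
    (hm' : ∀ (X : C) {Y Z : C} (f : Y ⟶ Z), Mono f → Mono (f ▷ X))
    (he : ∀ (X : C) {Y Z : C} (f : Y ⟶ Z), Epi f → Epi (X ◁ f))
    (he' : ∀ (X : C) {Y Z : C} (f : Y ⟶ Z), Epi f → Epi (f ▷ X)) (T : C) :
    (isPolynomial T).IsMonoidal where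
  prop_unit := by
    refine ⟨1, fun _ => 0, 𝟙_ C, biproduct.ι (fun _ : Fin 1 => tensorPow T 0) 0, 𝟙 _, ?_, ?_⟩
    · have : IsSplitMono (biproduct.ι (fun _ : Fin 1 => tensorPow T 0) 0) := inferInstance
      exact inferInstanceAs (Mono (biproduct.ι (fun _ : Fin 1 => tensorPow T 0) 0))
    · infer_instance
  prop_tensor := by
    rintro X Y ⟨k, a, Z, i, q, hi, hq⟩ ⟨l, b, W, j, r, hj, hr⟩
    have e1 : (⨁ fun i => tensorPow T (a i)) ⊗ (⨁ fun i => tensorPow T (b i)) ≅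
        ⨁ fun s : Fin (k * l) =>
          tensorPow T (a (finProdFinEquiv.symm s).1 + b (finProdFinEquiv.symm s).2) :=
      rightDistributor _ _ ≪≫ biproduct.mapIso (fun x => leftDistributor _ _) ≪≫
      (biproductBiproductIso (fun _ : Fin k => Fin l)
        (fun x y => tensorPow T (a x) ⊗ tensorPow T (b y))) ≪≫
      biproduct.whiskerEquiv ((Equiv.sigmaEquivProd (Fin k) (Fin l)).trans finProdFinEquiv)
        (fun s => (tensorPowAdd T _ _).symm ≪≫ eqToIso (by simp))
    refine ⟨k * l, _, Z ⊗ W, (i ⊗ₘ j) ≫ e1.hom, q ⊗ₘ r, ?_, ?_⟩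
    · rw [MonoidalCategory.tensorHom_def]
      have := hm' W i hi
      have := hm (⨁ fun i => tensorPow T (a i)) j hj
      infer_instance
    · rw [MonoidalCategory.tensorHom_def]
      have := he' W q hq
      have := he X r hr
      infer_instance

end General

/-! ### Flags of vector spaces -/

/-- A finite dimensional complex vector space `V` with a flag
`0 = V₀ ⊆ V₁ ⊆ ⋯ ⊆ Vₙ = V` of length `n`. -/
structure FlagCat (n : ℕ) where
  carrier : Type
  [addCommGroup : AddCommGroup carrier]
  [module : Module ℂ carrier]
  [finite : Module.Finite ℂ carrier]
  fil : Fin (n + 1) → Submodule ℂ carrier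
  mono : Monotone fil
  fil_zero : fil 0 = ⊥
  fil_last : fil (Fin.last n) = ⊤

attribute [instance] FlagCat.addCommGroup FlagCat.module FlagCat.finite

/-- A morphism of flags: a linear map with `f(Vᵢ) ⊆ Wᵢ` for all `i`. -/
@[ext]
structure FlagCat.Hom {n : ℕ} (V W : FlagCat n) where
  toLin : V.carrier →ₗ[ℂ] W.carrier
  map_fil : ∀ i, ∀ x ∈ V.fil i, toLin x ∈ W.fil i

instance (n : ℕ) : Category (FlagCat n) where
  Hom V W := FlagCat.Hom V W
  id V := ⟨LinearMap.id, fun _ _ h => h⟩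
  comp f g := ⟨g.toLin ∘ₗ f.toLin, fun i x h => g.map_fil i _ (f.map_fil i x h)⟩

/-- The functor that forgets the flag. -/
def flagForget (n : ℕ) : FlagCat n ⥤ FGModuleCat ℂ where
  obj V := FGModuleCat.of ℂ V.carrier
  map f := FGModuleCat.ofHom f.toLin

/-- The category of all functors from flags to finite dimensional vector spaces, with the
pointwise tensor product. -/
abbrev FlagFunctor (n : ℕ) := FlagCat n ⥤ FGModuleCat ℂ

instance (n : ℕ) : Limits.HasFiniteBiproducts (FlagFunctor n) :=
  Abelian.hasFiniteBiproducts

instance (n : ℕ) : MonoidalPreadditive (FlagFunctor n) where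

/-- Polynomial functors: the subquotients of finite direct sums of the functors
`{Vᵢ} ↦ V^{⊗a}`. -/
def isPolyFunctor (n : ℕ) : ObjectProperty (FlagFunctor n) :=
  isPolynomial (flagForget n)

theorem fg_mono_iff {X Y : FGModuleCat ℂ} (f : X ⟶ Y) :
    Mono f ↔ Function.Injective f.hom.hom :=
  ⟨fun _ => (ModuleCat.mono_iff_injective ((forget₂ _ (ModuleCat ℂ)).map f)).1 inferInstance,
    fun h => (forget₂ _ (ModuleCat ℂ)).mono_of_mono_map
      ((ModuleCat.mono_iff_injective ((forget₂ _ (ModuleCat ℂ)).map f)).2 h)⟩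

theorem fg_epi_iff {X Y : FGModuleCat ℂ} (f : X ⟶ Y) :
    Epi f ↔ Function.Surjective f.hom.hom :=
  ⟨fun _ => (ModuleCat.epi_iff_surjective ((forget₂ _ (ModuleCat ℂ)).map f)).1 inferInstance,
    fun h => (forget₂ _ (ModuleCat ℂ)).epi_of_epi_map
      ((ModuleCat.epi_iff_surjective ((forget₂ _ (ModuleCat ℂ)).map f)).2 h)⟩

instance (n : ℕ) : (isPolyFunctor n).IsMonoidal := by
  apply isPolynomial_isMonoidal
  · intro X Y Z f hf
    rw [NatTrans.mono_iff_mono_app] at hf ⊢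
    intro c
    have h := (fg_mono_iff _).1 (hf c)
    exact (fg_mono_iff _).2 (Module.Flat.lTensor_preserves_injective_linearMap _ h)
  · intro X Y Z f hf
    rw [NatTrans.mono_iff_mono_app] at hf ⊢
    intro c
    have h := (fg_mono_iff _).1 (hf c)
    exact (fg_mono_iff _).2 (Module.Flat.rTensor_preserves_injective_linearMap _ h)
  · intro X Y Z f hf
    rw [NatTrans.epi_iff_epi_app] at hf ⊢
    intro c
    have h := (fg_epi_iff _).1 (hf c)
    exact (fg_epi_iff _).2 (LinearMap.lTensor_surjective _ h)
  · intro X Y Z f hf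
    rw [NatTrans.epi_iff_epi_app] at hf ⊢
    intro c
    have h := (fg_epi_iff _).1 (hf c)
    exact (fg_epi_iff _).2 (LinearMap.rTensor_surjective _ h)

/-- The tensor category of polynomial functors from flags of length `n` to finite dimensional
vector spaces. -/
abbrev PolyFunctor (n : ℕ) := (isPolyFunctor n).FullSubcategory

/-! ### The infinite rank group and its polynomial representations -/

/-- The standard representation, with basis `e_{i,m}` for `i` in `Fin n` and `m` in `ℕ`. -/
abbrev VInf (n : ℕ) := (Fin n × ℕ) →₀ ℂ

/-- The step `Vᵢ` of the flag on the standard representation, spanned by the basis vectors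
of the first `i` graded pieces. -/
def flagSub (n : ℕ) (i : Fin (n + 1)) : Submodule ℂ (VInf n) :=
  Finsupp.supported ℂ ℂ {p | (p.1 : ℕ) < i}

/-- The subspace `ℂ^a`, spanned by the first `aᵢ` basis vectors of the `i`-th graded piece
for all `i`. -/
def stdSub {n : ℕ} (a : Fin n → ℕ) : Submodule ℂ (VInf n) :=
  Finsupp.supported ℂ ℂ {p | p.2 < a p.1}

/-- The constant tuple `(jⁿ) = (j, …, j)`. -/
abbrev cst (n j : ℕ) : Fin n → ℕ := fun _ => j

/-- `A` lies in the `j`-th finite level: it maps `ℂ^{(jⁿ)}` to itself and fixes all other basis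
vectors. -/
def IsLevel {n : ℕ} (j : ℕ) (A : VInf n →ₗ[ℂ] VInf n) : Prop :=
  (∀ x ∈ stdSub (cst n j), A x ∈ stdSub (cst n j)) ∧
    ∀ p : Fin n × ℕ, j ≤ p.2 → A (Finsupp.single p 1) = Finsupp.single p 1

theorem stdSub_mono {n : ℕ} {a b : Fin n → ℕ} (h : a ≤ b) : stdSub a ≤ stdSub b :=
  Finsupp.supported_mono fun p (hp : p.2 < a p.1) => lt_of_lt_of_le hp (h p.1)

theorem single_mem_stdSub {n : ℕ} {a : Fin n → ℕ} {p : Fin n × ℕ} (h : p.2 < a p.1) (c : ℂ) :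
    Finsupp.single p c ∈ stdSub a :=
  Finsupp.single_mem_supported ℂ c h

theorem stdSub_induction {n : ℕ} {a : Fin n → ℕ} {W : Submodule ℂ (VInf n)}
    (h : ∀ p : Fin n × ℕ, p.2 < a p.1 → Finsupp.single p 1 ∈ W) : stdSub a ≤ W := by
  rw [stdSub, Finsupp.supported_eq_span_single, Submodule.span_le]
  rintro _ ⟨p, hp, rfl⟩
  exact h p hp

theorem IsLevel.mono {n : ℕ} {j k : ℕ} (hjk : j ≤ k) {A : VInf n →ₗ[ℂ] VInf n}
    (h : IsLevel j A) : IsLevel k A := by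
  refine ⟨fun x hx => ?_, fun p hp => h.2 p (hjk.trans hp)⟩
  refine stdSub_induction (W := (stdSub (cst n k)).comap A) (fun p hp => ?_) hx
  rw [Submodule.mem_comap]
  by_cases hj : j ≤ p.2
  · rw [h.2 p hj]; exact single_mem_stdSub hp 1
  · exact stdSub_mono (fun _ => hjk) (h.1 _ (single_mem_stdSub (not_le.1 hj) 1))

theorem IsLevel.id {n : ℕ} (j : ℕ) : IsLevel j (LinearMap.id : VInf n →ₗ[ℂ] VInf n) :=
  ⟨fun _ h => h, fun _ _ => rfl⟩

theorem IsLevel.comp {n : ℕ} {j : ℕ} {A B : VInf n →ₗ[ℂ] VInf n} (hA : IsLevel j A)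
    (hB : IsLevel j B) : IsLevel j (A ∘ₗ B) :=
  ⟨fun x hx => hA.1 _ (hB.1 x hx), fun p hp => by
    rw [LinearMap.comp_apply, hB.2 p hp, hA.2 p hp]⟩

theorem exists_mem_stdSub {n : ℕ} (x : VInf n) : ∃ j, x ∈ stdSub (cst n j) := by
  refine ⟨x.support.sup (fun p => p.2) + 1, ?_⟩
  rw [stdSub, Finsupp.mem_supported]
  intro p hp
  exact Nat.lt_succ_of_le (Finset.le_sup (f := fun p : Fin n × ℕ => p.2) hp)

/-- `x` is the sum of its part in `ℂ^{(jⁿ)}` and of a vector supported outside. -/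
theorem split_level {n : ℕ} (j : ℕ) (x : VInf n) : ∃ y z, x = y + z ∧ y ∈ stdSub (cst n j) ∧
    z ∈ Finsupp.supported ℂ ℂ {p : Fin n × ℕ | j ≤ p.2} ∧
    (∀ i, x ∈ flagSub n i → y ∈ flagSub n i ∧ z ∈ flagSub n i) := by
  classical
  refine ⟨x.filter (fun p => p.2 < j), x.filter (fun p => ¬ p.2 < j),
    (Finsupp.filter_add_filter_not x _).symm, ?_, ?_, ?_⟩
  · rw [stdSub, Finsupp.mem_supported]
    intro p hp
    rw [Finsupp.support_filter, Finset.mem_coe, Finset.mem_filter] at hp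
    exact hp.2
  · rw [Finsupp.mem_supported]
    intro p hp
    rw [Finsupp.support_filter, Finset.mem_coe, Finset.mem_filter] at hp
    exact not_lt.1 hp.2
  · intro i hx
    rw [flagSub, Finsupp.mem_supported] at *
    rw [Finsupp.mem_supported]
    constructor
    · intro p hp
      rw [Finsupp.support_filter, Finset.mem_coe, Finset.mem_filter] at hp
      exact hx hp.1
    · intro p hp
      rw [Finsupp.support_filter, Finset.mem_coe, Finset.mem_filter] at hp
      exact hx hp.1

theorem IsLevel.fix {n : ℕ} {j : ℕ} {A : VInf n →ₗ[ℂ] VInf n} (hA : IsLevel j A) {z : VInf n}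
    (hz : z ∈ Finsupp.supported ℂ ℂ {p : Fin n × ℕ | j ≤ p.2}) : A z = z := by
  have : Finsupp.supported ℂ ℂ {p : Fin n × ℕ | j ≤ p.2} ≤ LinearMap.eqLocus A LinearMap.id := by
    rw [Finsupp.supported_eq_span_single, Submodule.span_le]
    rintro _ ⟨p, hp, rfl⟩
    exact hA.2 p hp
  exact this hz

/-- The group `𝐆`: the invertible finitary matrices (the union of the groups of invertible
matrices of the finite levels) that preserve the flag of the standard representation. -/
def G (n : ℕ) : Subgroup (VInf n ≃ₗ[ℂ] VInf n) where
  carrier := {g | (∀ i, (flagSub n i).map (g : VInf n →ₗ[ℂ] VInf n) = flagSub n i) ∧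
    ∃ j, IsLevel j (g : VInf n →ₗ[ℂ] VInf n) ∧ IsLevel j (g.symm : VInf n →ₗ[ℂ] VInf n)}
  one_mem' := ⟨fun i => Submodule.map_id _, 0, IsLevel.id 0, IsLevel.id 0⟩
  mul_mem' := by
    rintro g h ⟨hg, j, hj, hj'⟩ ⟨hh, k, hk, hk'⟩
    refine ⟨fun i => ?_, max j k, ?_, ?_⟩
    · have : ((g * h : VInf n ≃ₗ[ℂ] VInf n) : VInf n →ₗ[ℂ] VInf n) =
        (g : VInf n →ₗ[ℂ] VInf n) ∘ₗ (h : VInf n →ₗ[ℂ] VInf n) := rfl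
      rw [this, Submodule.map_comp, hh, hg]
    · exact (hj.mono (le_max_left j k)).comp (hk.mono (le_max_right j k))
    · exact (hk'.mono (le_max_right j k)).comp (hj'.mono (le_max_left j k))
  inv_mem' := by
    rintro g ⟨hg, j, hj, hj'⟩
    refine ⟨fun i => ?_, j, hj', hj⟩
    conv_lhs => rw [← hg i]
    rw [← Submodule.map_comp]
    have : ((g⁻¹ : VInf n ≃ₗ[ℂ] VInf n) : VInf n →ₗ[ℂ] VInf n) ∘ₗ
        (g : VInf n →ₗ[ℂ] VInf n) = LinearMap.id := by
      refine LinearMap.ext fun x => ?_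
      exact g.symm_apply_apply x
    rw [this, Submodule.map_id]

/-- The linear endomorphism of the standard representation underlying an element of `𝐆`. -/
def toEnd {n : ℕ} (g : G n) : VInf n →ₗ[ℂ] VInf n := ((g : VInf n ≃ₗ[ℂ] VInf n) : _ →ₗ[ℂ] _)

/-- The standard representation of `𝐆`. -/
def stdRep (n : ℕ) : Rep.{0} ℂ (G n) :=
  Rep.of (X := VInf n)
    { toFun := fun g => toEnd g
      map_one' := rfl
      map_mul' := fun _ _ => rfl }

instance (n : ℕ) : Limits.HasFiniteBiproducts (Rep.{0} ℂ (G n)) :=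
  Abelian.hasFiniteBiproducts

/-- Polynomial representations of `𝐆`: the subquotients of finite direct sums of tensor powers
of the standard representation. -/
def isPolyRep (n : ℕ) : ObjectProperty (Rep.{0} ℂ (G n)) :=
  isPolynomial (stdRep n)

instance (n : ℕ) : (isPolyRep n).IsMonoidal := by
  apply isPolynomial_isMonoidal
  · intro X Y Z f hf
    rw [Rep.mono_iff_injective] at hf ⊢
    exact Module.Flat.lTensor_preserves_injective_linearMap f.hom.toLinearMap hf
  · intro X Y Z f hf
    rw [Rep.mono_iff_injective] at hf ⊢
    exact Module.Flat.rTensor_preserves_injective_linearMap f.hom.toLinearMap hf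
  · intro X Y Z f hf
    rw [Rep.epi_iff_surjective] at hf ⊢
    exact LinearMap.lTensor_surjective X (g := f.hom.toLinearMap) hf
  · intro X Y Z f hf
    rw [Rep.epi_iff_surjective] at hf ⊢
    exact LinearMap.rTensor_surjective X (g := f.hom.toLinearMap) hf

/-- The tensor category `Rep(𝐆)` of polynomial representations of `𝐆`. -/
abbrev PolyRep (n : ℕ) := (isPolyRep n).FullSubcategory

/-! ### The direct limit functor -/

theorem finite_stdSub_index {n : ℕ} (a : Fin n → ℕ) : {p : Fin n × ℕ | p.2 < a p.1}.Finite := by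
  refine Set.Finite.subset
    ((Set.finite_univ (α := Fin n)).prod (Set.finite_Iio (Finset.univ.sup a))) ?_
  intro p hp
  have h : p.2 < a p.1 := hp
  exact ⟨Set.mem_univ _, Set.mem_Iio.2 (h.trans_le (Finset.le_sup (Finset.mem_univ p.1)))⟩

instance {n : ℕ} (a : Fin n → ℕ) : Module.Finite ℂ (stdSub a) := by
  have := (finite_stdSub_index a).to_subtype
  exact Module.Finite.equiv
    (Finsupp.supportedEquivFinsupp (M := ℂ) (R := ℂ) {p : Fin n × ℕ | p.2 < a p.1}).symm

theorem flagSub_mono (n : ℕ) : Monotone (flagSub n) := by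
  intro i j hij
  refine Finsupp.supported_mono fun p hp => ?_
  have h : (p.1 : ℕ) < (i : ℕ) := hp
  exact h.trans_le (Fin.le_def.1 hij)

/-- The flag `0 ⊆ ℂ^{a₁} ⊆ ℂ^{a₁+a₂} ⊆ ⋯ ⊆ ℂ^{|a|}`, realised inside the standard
representation. -/
def stdFlag {n : ℕ} (a : Fin n → ℕ) : FlagCat n where
  carrier := stdSub a
  fil i := (flagSub n i).comap (stdSub a).subtype
  mono i j hij := Submodule.comap_mono (flagSub_mono n hij)
  fil_zero := by
    rw [eq_bot_iff]
    intro x hx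
    have h : flagSub n 0 = ⊥ := by simp [flagSub]
    rw [Submodule.mem_comap, h, Submodule.mem_bot] at hx
    exact (Submodule.mem_bot ℂ).2 (Subtype.ext hx)
  fil_last := by
    have h : flagSub n (Fin.last n) = ⊤ := by simp [flagSub]
    rw [h, Submodule.comap_top]

/-- `A` preserves the flag of the standard representation. -/
def PreservesFlag {n : ℕ} (A : VInf n →ₗ[ℂ] VInf n) : Prop :=
  ∀ i, ∀ x ∈ flagSub n i, A x ∈ flagSub n i

theorem PreservesFlag.id {n : ℕ} : PreservesFlag (LinearMap.id : VInf n →ₗ[ℂ] VInf n) :=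
  fun _ _ h => h

theorem PreservesFlag.comp {n : ℕ} {A B : VInf n →ₗ[ℂ] VInf n} (hA : PreservesFlag A)
    (hB : PreservesFlag B) : PreservesFlag (A ∘ₗ B) :=
  fun i x h => hA i _ (hB i x h)

theorem preservesFlag_toEnd {n : ℕ} (g : G n) : PreservesFlag (toEnd g) := by
  intro i x hx
  have h := g.2.1 i
  rw [← h]
  exact Submodule.mem_map_of_mem hx

theorem exists_level {n : ℕ} (g : G n) : ∃ j, IsLevel j (toEnd g) :=
  let ⟨j, hj, _⟩ := g.2.2
  ⟨j, hj⟩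

/-- The morphism `ℂ^a ⟶ ℂ^b` of flags induced by a flag preserving endomorphism of the standard
representation that maps `ℂ^a` into `ℂ^b`. -/
def stdHom {n : ℕ} {a b : Fin n → ℕ} (A : VInf n →ₗ[ℂ] VInf n) (hA : PreservesFlag A)
    (h : ∀ x ∈ stdSub a, A x ∈ stdSub b) : stdFlag a ⟶ stdFlag b :=
  FlagCat.Hom.mk (V := stdFlag a) (W := stdFlag b) (A.restrict h) fun i x hx =>
    hA i ((stdSub a).subtype x) hx

theorem stdHom_comp {n : ℕ} {a b c : Fin n → ℕ} {A B : VInf n →ₗ[ℂ] VInf n}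
    (hA : PreservesFlag A) (hB : PreservesFlag B) (h : ∀ x ∈ stdSub a, A x ∈ stdSub b)
    (h' : ∀ x ∈ stdSub b, B x ∈ stdSub c) :
    stdHom A hA h ≫ stdHom B hB h' =
      stdHom (B ∘ₗ A) (hB.comp hA) (fun x hx => h' _ (h x hx)) := rfl

/-- The natural morphism `ℂ^a ⟶ ℂ^b` for `a ≤ b`. -/
def stdIncl {n : ℕ} {a b : Fin n → ℕ} (h : a ≤ b) : stdFlag a ⟶ stdFlag b :=
  stdHom LinearMap.id PreservesFlag.id fun _ hx => stdSub_mono h hx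

section Limit

variable {n : ℕ} (F : FlagFunctor n)

/-- The value `F(ℂ^a)`. -/
abbrev stdVal (a : Fin n → ℕ) : Type := (F.obj (stdFlag a)).obj

/-- The linear map `F(f)`. -/
abbrev mapLin {V W : FlagCat n} (f : V ⟶ W) : (F.obj V).obj →ₗ[ℂ] (F.obj W).obj :=
  (F.map f).hom.hom

theorem mapLin_comp {U V W : FlagCat n} (f : U ⟶ V) (g : V ⟶ W) (x : (F.obj U).obj) :
    mapLin F g (mapLin F f x) = mapLin F (f ≫ g) x := by
  simp [mapLin]

/-- The direct limit of the spaces `F(ℂ^{(jⁿ)})`. -/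
abbrev LimSpace : Type :=
  Module.DirectLimit (fun j : ℕ => stdVal F (cst n j))
    (fun _ _ h => mapLin F (stdIncl fun _ => h))

/-- The canonical map from `F(ℂ^{(jⁿ)})` to the direct limit. -/
abbrev limOf (j : ℕ) : stdVal F (cst n j) →ₗ[ℂ] LimSpace F :=
  Module.DirectLimit.of ℂ ℕ (fun j : ℕ => stdVal F (cst n j))
    (fun _ _ h => mapLin F (stdIncl fun _ => h)) j

theorem limOf_incl {j k : ℕ} (h : cst n j ≤ cst n k) (hjk : j ≤ k) (x : stdVal F (cst n j)) :
    limOf F k (mapLin F (stdIncl h) x) = limOf F j x :=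
  Module.DirectLimit.of_f (hij := hjk)

theorem IsLevel.maps {A : VInf n →ₗ[ℂ] VInf n} {l : ℕ} (h : IsLevel l A) {j k : ℕ} (hj : j ≤ k)
    (hl : l ≤ k) : ∀ x ∈ stdSub (cst n j), A x ∈ stdSub (cst n k) :=
  fun _ hx => (h.mono hl).1 _ (stdSub_mono (fun _ => hj) hx)

/-- The action of an element of `𝐆` on the direct limit: on `F(ℂ^{(jⁿ)})` it is given by `F`
applied to the morphism `ℂ^{(jⁿ)} ⟶ ℂ^{(kⁿ)}` that it induces for large `k`. -/
def limAct (g : G n) : LimSpace F →ₗ[ℂ] LimSpace F :=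
  Module.DirectLimit.lift ℂ ℕ _ _
    (fun j => limOf F (max j (exists_level g).choose) ∘ₗ
      mapLin F (stdHom (toEnd g) (preservesFlag_toEnd g)
        ((exists_level g).choose_spec.maps (le_max_left _ _) (le_max_right _ _))))
    (by
      intro i j hij x
      simp only [LinearMap.comp_apply]
      rw [mapLin_comp]
      rw [← limOf_incl F (j := max i (exists_level g).choose) (k := max j (exists_level g).choose)
        (fun _ => max_le_max_right _ hij) (max_le_max_right _ hij), mapLin_comp]
      rfl)

theorem limAct_of (g : G n) {j k : ℕ} (h : ∀ x ∈ stdSub (cst n j), toEnd g x ∈ stdSub (cst n k))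
    (x : stdVal F (cst n j)) :
    limAct F g (limOf F j x) =
      limOf F k (mapLin F (stdHom (toEnd g) (preservesFlag_toEnd g) h) x) := by
  rw [limAct, limOf, Module.DirectLimit.lift_of]
  simp only [LinearMap.comp_apply]
  set m := max j (exists_level g).choose
  rw [← limOf_incl F (j := m) (k := max m k) (fun _ => le_max_left _ _) (le_max_left _ _),
    ← limOf_incl F (j := k) (k := max m k) (fun _ => le_max_right _ _) (le_max_right _ _),
    mapLin_comp, mapLin_comp]
  rfl

/-- The representation of `𝐆` on the direct limit of the spaces `F(ℂ^{(jⁿ)})`. -/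
def limRep : Representation ℂ (G n) (LimSpace F) where
  toFun := limAct F
  map_one' := by
    refine LinearMap.ext fun z => ?_
    induction z using Module.DirectLimit.induction_on with
    | _ j x =>
      rw [limAct_of F 1 (k := j) (fun x hx => hx)]
      have : stdHom (toEnd (1 : G n)) (preservesFlag_toEnd 1) (fun x hx => hx) =
        𝟙 (stdFlag (cst n j)) := rfl
      rw [this]
      simp [mapLin]
  map_mul' g h := by
    refine LinearMap.ext fun z => ?_
    induction z using Module.DirectLimit.induction_on with
    | _ j x =>
      obtain ⟨l, hl⟩ := exists_level h
      obtain ⟨m, hm⟩ := exists_level g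
      have h1 := hl.maps (le_max_left j l) (le_max_right j l)
      have h2 := hm.maps (le_max_left (max j l) m) (le_max_right (max j l) m)
      rw [Module.End.mul_apply, limAct_of F h h1, limAct_of F g h2, mapLin_comp,
        limAct_of F (g * h) (k := max (max j l) m) (fun x hx => h2 _ (h1 x hx))]
      rfl

variable {F} in
/-- The map on direct limits induced by a natural transformation. -/
def limMap {F' : FlagFunctor n} (η : F ⟶ F') : LimSpace F →ₗ[ℂ] LimSpace F' :=
  Module.DirectLimit.map (fun j => (η.app (stdFlag (cst n j))).hom.hom)
    (fun i j h => congrArg (fun f => f.hom.hom) (η.naturality (stdIncl (n := n)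
      (a := cst n i) (b := cst n j) fun _ => h)))

variable {F} in
theorem limMap_of {F' : FlagFunctor n} (η : F ⟶ F') (j : ℕ) (x : stdVal F (cst n j)) :
    limMap η (limOf F j x) = limOf F' j ((η.app (stdFlag (cst n j))).hom.hom x) :=
  Module.DirectLimit.map_apply_of _ _ _

end Limit

/-- The functor `F ↦ lim F(ℂ^{(jⁿ)})` (direct limit) from functors on flags to representations
of `𝐆`. -/
def limFunctor (n : ℕ) : FlagFunctor n ⥤ Rep.{0} ℂ (G n) where
  obj F := Rep.of (limRep F)
  map {F F'} η := Rep.ofHom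
    { toLinearMap := limMap η
      isIntertwining' := fun g => by
        refine LinearMap.ext fun z => ?_
        induction z using Module.DirectLimit.induction_on with
        | _ j x =>
          obtain ⟨l, hl⟩ := exists_level g
          have h1 := hl.maps (le_max_left j l) (le_max_right j l)
          rw [LinearMap.comp_apply, LinearMap.comp_apply]
          change limMap η (limAct F g (limOf F j x)) = limAct F' g (limMap η (limOf F j x))
          rw [limAct_of F g h1, limMap_of, limMap_of, limAct_of F' g h1]
          exact congrArg _ (congrArg (fun f => f.hom.hom x) (η.naturality
            (stdHom (toEnd g) (preservesFlag_toEnd g) h1))) }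
  map_id F := by
    refine Rep.hom_ext (Representation.IntertwiningMap.toLinearMap_injective _ _
      (LinearMap.ext fun z => ?_))
    induction z using Module.DirectLimit.induction_on with
    | _ j x => exact limMap_of (𝟙 F) j x
  map_comp {F F' F''} η θ := by
    refine Rep.hom_ext (Representation.IntertwiningMap.toLinearMap_injective _ _
      (LinearMap.ext fun z => ?_))
    induction z using Module.DirectLimit.induction_on with
    | _ j x =>
      change limMap (η ≫ θ) (limOf F j x) = limMap θ (limMap η (limOf F j x))
      rw [limMap_of, limMap_of, limMap_of]
      rfl

/-! ### The action of the monoid of endomorphisms on polynomial representations -/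

/-- A polynomial map between vector spaces: a finite sum of the maps `x ↦ c(x) • v`, where `c` is
in the algebra of functions generated by the linear functionals. -/
def IsPolyMap {E V : Type} [AddCommGroup E] [Module ℂ E] [AddCommGroup V] [Module ℂ V]
    (p : E → V) : Prop :=
  p ∈ Submodule.span ℂ {q : E → V |
    ∃ c ∈ Algebra.adjoin ℂ {φ : E → ℂ | ∃ l : E →ₗ[ℂ] ℂ, φ = l}, ∃ v : V, q = fun x => c x • v}

namespace IsPolyMap

variable {E E' V W : Type} [AddCommGroup E] [Module ℂ E] [AddCommGroup E'] [Module ℂ E']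
  [AddCommGroup V] [Module ℂ V] [AddCommGroup W] [Module ℂ W]

theorem add {p q : E → V} (hp : IsPolyMap p) (hq : IsPolyMap q) : IsPolyMap (p + q) :=
  Submodule.add_mem _ hp hq

theorem sub {p q : E → V} (hp : IsPolyMap p) (hq : IsPolyMap q) : IsPolyMap (p - q) :=
  Submodule.sub_mem _ hp hq

theorem smul (c : ℂ) {p : E → V} (hp : IsPolyMap p) : IsPolyMap (c • p) :=
  Submodule.smul_mem _ c hp

theorem sum {ι : Type} (s : Finset ι) {p : ι → E → V} (hp : ∀ i ∈ s, IsPolyMap (p i)) :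
    IsPolyMap (∑ i ∈ s, p i) :=
  Submodule.sum_mem _ hp

theorem const (v : V) : IsPolyMap (fun _ : E => v) :=
  Submodule.subset_span ⟨1, one_mem _, v, by simp⟩

theorem linear (l : E →ₗ[ℂ] ℂ) (v : V) : IsPolyMap (fun x => l x • v) :=
  Submodule.subset_span ⟨l, Algebra.subset_adjoin ⟨l, rfl⟩, v, rfl⟩

theorem map (f : V →ₗ[ℂ] W) {p : E → V} (hp : IsPolyMap p) : IsPolyMap (fun x => f (p x)) := by
  induction hp using Submodule.span_induction with
  | mem q hq =>
    obtain ⟨c, hc, v, rfl⟩ := hq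
    exact Submodule.subset_span ⟨c, hc, f v, by simp⟩
  | zero => simpa using const (E := E) (0 : W)
  | add p q _ _ hp hq => simpa using! hp.add hq
  | smul c p _ hp => simpa using! hp.smul c

theorem precomp (f : E' →ₗ[ℂ] E) {p : E → V} (hp : IsPolyMap p) :
    IsPolyMap (fun x => p (f x)) := by
  induction hp using Submodule.span_induction with
  | mem q hq =>
    obtain ⟨c, hc, v, rfl⟩ := hq
    refine Submodule.subset_span ⟨fun x => c (f x), ?_, v, rfl⟩
    induction hc using Algebra.adjoin_induction with
    | mem c hc =>
      obtain ⟨l, rfl⟩ := hc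
      exact Algebra.subset_adjoin ⟨l ∘ₗ f, rfl⟩
    | algebraMap r => exact Subalgebra.algebraMap_mem _ r
    | add c d _ _ hc hd => exact add_mem hc hd
    | mul c d _ _ hc hd => exact mul_mem hc hd
  | zero => exact const (E := E') (0 : V)
  | add p q _ _ hp hq => exact hp.add hq
  | smul c p _ hp => exact hp.smul c

theorem tmul {p : E → V} {q : E → W} (hp : IsPolyMap p) (hq : IsPolyMap q) :
    IsPolyMap (fun x => TensorProduct.tmul ℂ (p x) (q x)) := by
  induction hp using Submodule.span_induction with
  | mem p hp =>
    obtain ⟨c, hc, v, rfl⟩ := hp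
    induction hq using Submodule.span_induction with
    | mem q hq =>
      obtain ⟨d, hd, w, rfl⟩ := hq
      refine Submodule.subset_span ⟨c * d, mul_mem hc hd, TensorProduct.tmul ℂ v w, ?_⟩
      funext x
      simp only [TensorProduct.smul_tmul_smul, Pi.mul_apply]
    | zero => simpa using const (E := E) (0 : TensorProduct ℂ V W)
    | add p q _ _ hp hq => simpa [TensorProduct.tmul_add] using! hp.add hq
    | smul c p _ hp => simpa using! hp.smul c
  | zero => simpa using const (E := E) (0 : TensorProduct ℂ V W)
  | add p q _ _ hp hq => simpa [TensorProduct.add_tmul] using! hp.add hq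
  | smul c p _ hp => simpa [TensorProduct.smul_tmul'] using! hp.smul c

/-- On a line, a polynomial function is a polynomial in the parameter. -/
theorem exists_line (φ : V →ₗ[ℂ] ℂ) {p : E → V} (hp : IsPolyMap p) (a b : E) :
    ∃ Q : Polynomial ℂ, ∀ t : ℂ, φ (p (a + t • b)) = Q.eval t := by
  induction hp using Submodule.span_induction with
  | mem q hq =>
    obtain ⟨c, hc, v, rfl⟩ := hq
    have : ∃ Q : Polynomial ℂ, ∀ t : ℂ, c (a + t • b) = Q.eval t := by
      induction hc using Algebra.adjoin_induction with
      | mem c hc =>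
        obtain ⟨l, rfl⟩ := hc
        exact ⟨Polynomial.C (l a) + Polynomial.X * Polynomial.C (l b), fun t => by simp [mul_comm t]⟩
      | algebraMap r => exact ⟨Polynomial.C r, fun t => by simp⟩
      | add c d _ _ hc hd =>
        obtain ⟨Q, hQ⟩ := hc
        obtain ⟨R, hR⟩ := hd
        exact ⟨Q + R, fun t => by simp [hQ, hR]⟩
      | mul c d _ _ hc hd =>
        obtain ⟨Q, hQ⟩ := hc
        obtain ⟨R, hR⟩ := hd
        exact ⟨Q * R, fun t => by simp [hQ, hR]⟩
    obtain ⟨Q, hQ⟩ := this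
    exact ⟨Q * Polynomial.C (φ v), fun t => by simp [hQ]⟩
  | zero => exact ⟨0, fun t => by simp⟩
  | add p q _ _ hp hq =>
    obtain ⟨Q, hQ⟩ := hp
    obtain ⟨R, hR⟩ := hq
    exact ⟨Q + R, fun t => by simp [hQ, hR]⟩
  | smul c p _ hp =>
    obtain ⟨Q, hQ⟩ := hp
    exact ⟨Polynomial.C c * Q, fun t => by simp [hQ]⟩

end IsPolyMap

/-- An injective endomorphism of a finite level that preserves the flag belongs to `𝐆`. -/
theorem exists_toEnd_eq {n j : ℕ} {A : VInf n →ₗ[ℂ] VInf n} (hA : PreservesFlag A)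
    (hj : IsLevel j A) (h0 : ∀ x ∈ stdSub (cst n j), A x = 0 → x = 0) :
    ∃ g : G n, toEnd g = A := by
  have hinj : Function.Injective A := by
    rw [injective_iff_map_eq_zero]
    intro x hx
    obtain ⟨y, z, rfl, hy, hz, -⟩ := split_level j x
    rw [map_add, hj.fix hz] at hx
    have hz' : z ∈ stdSub (cst n j) := by
      rw [← neg_eq_of_add_eq_zero_right hx]
      exact neg_mem (hj.1 y hy)
    have hz0 : z = 0 := by
      have hd : Disjoint {p : Fin n × ℕ | p.2 < cst n j p.1} {p : Fin n × ℕ | j ≤ p.2} := by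
        rw [Set.disjoint_left]
        intro p hp hp'
        exact absurd (show j ≤ p.2 from hp') (not_le.2 hp)
      exact (Submodule.disjoint_def.1 (Finsupp.disjoint_supported_supported (R := ℂ) (M := ℂ) hd))
        z hz' hz
    subst hz0
    rw [add_zero] at hx ⊢
    exact h0 y hy hx
  have hsurj : ∀ i, ∀ x ∈ flagSub n i, ∃ y ∈ flagSub n i, A y = x ∧
      (x ∈ stdSub (cst n j) → y ∈ stdSub (cst n j)) := by
    intro i x hx
    obtain ⟨y, z, hxyz, hy, hz, hf⟩ := split_level j x
    have hm : ∀ w ∈ stdSub (cst n j) ⊓ flagSub n i, A w ∈ stdSub (cst n j) ⊓ flagSub n i :=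
      fun w hw => ⟨hj.1 w hw.1, hA i w hw.2⟩
    have : FiniteDimensional ℂ ↥(stdSub (cst n j) ⊓ flagSub n i) :=
      Submodule.finiteDimensional_inf_left _ _
    have hs : Function.Surjective (A.restrict hm) := by
      refine LinearMap.surjective_of_injective (K := ℂ)
        (V := ↥(stdSub (cst n j) ⊓ flagSub n i)) (f := A.restrict hm) ?_
      intro u v huv
      exact Subtype.ext (hinj (congrArg Subtype.val huv))
    obtain ⟨⟨w, hw⟩, hwy⟩ := hs ⟨y, hy, (hf i hx).1⟩
    have hwy' : A w = y := congrArg Subtype.val hwy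
    refine ⟨w + z, add_mem hw.2 (hf i hx).2, ?_, fun hx' => ?_⟩
    · rw [map_add, hwy', hj.fix hz, hxyz]
    · refine add_mem hw.1 ?_
      have : z = x - y := by rw [hxyz]; abel
      rw [this]
      exact sub_mem hx' hy
  have hsj : Function.Surjective A := by
    intro x
    obtain ⟨y, -, hy, -⟩ := hsurj (Fin.last n) x (by
      have h : flagSub n (Fin.last n) = ⊤ := by simp [flagSub]
      rw [h]; trivial)
    exact ⟨y, hy⟩
  let g : VInf n ≃ₗ[ℂ] VInf n := LinearEquiv.ofBijective A ⟨hinj, hsj⟩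
  refine ⟨⟨g, fun i => ?_, j, hj, fun x hx => ?_, fun p hp => ?_⟩, rfl⟩
  · refine le_antisymm (Submodule.map_le_iff_le_comap.2 fun x hx => hA i x hx) fun x hx => ?_
    obtain ⟨y, hy, hyx, -⟩ := hsurj i x hx
    exact ⟨y, hy, hyx⟩
  · obtain ⟨y, -, hy, hy'⟩ := hsurj (Fin.last n) x (by
      have h : flagSub n (Fin.last n) = ⊤ := by simp [flagSub]
      rw [h]; trivial)
    have : g.symm x = y := by rw [LinearEquiv.symm_apply_eq]; exact hy.symm
    change g.symm x ∈ _
    rw [this]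
    exact hy' hx
  · change g.symm _ = _
    rw [LinearEquiv.symm_apply_eq]
    exact (hj.2 p hp).symm

/-- A polynomial map that vanishes on the elements of `𝐆` of level `j` vanishes on all flag
preserving endomorphisms of level `j`. -/
theorem poly_vanish {n j : ℕ} {V : Type} [AddCommGroup V] [Module ℂ V]
    {p : (VInf n →ₗ[ℂ] VInf n) → V} (hp : IsPolyMap p)
    (h : ∀ g : G n, IsLevel j (toEnd g) → p (toEnd g) = 0)
    {A : VInf n →ₗ[ℂ] VInf n} (hA : PreservesFlag A) (hj : IsLevel j A) : p A = 0 := by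
  rw [← Module.forall_dual_apply_eq_zero_iff ℂ]
  intro φ
  obtain ⟨Q, hQ⟩ := hp.exists_line φ A (LinearMap.id - A)
  let S : Set ℂ := {μ | Module.End.HasEigenvalue (M := stdSub (cst n j)) (A.restrict hj.1) μ}
  have hS : S.Finite := Module.End.finite_hasEigenvalue _
  let T : Set ℂ := (fun μ => μ / (μ - 1)) '' S
  have hT : T.Finite := hS.image _
  have hroot : ∀ t ∈ Tᶜ, Q.IsRoot t := by
    intro t ht
    have hfl : PreservesFlag (A + t • (LinearMap.id - A)) := fun i x hx => by
      simp only [LinearMap.add_apply, LinearMap.smul_apply, LinearMap.sub_apply, LinearMap.id_apply]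
      exact add_mem (hA i x hx) (Submodule.smul_mem _ _ (sub_mem hx (hA i x hx)))
    have hlv : IsLevel j (A + t • (LinearMap.id - A)) := by
      refine ⟨fun x hx => ?_, fun p hp => ?_⟩
      · simp only [LinearMap.add_apply, LinearMap.smul_apply, LinearMap.sub_apply,
          LinearMap.id_apply]
        exact add_mem (hj.1 x hx) (Submodule.smul_mem _ _ (sub_mem hx (hj.1 x hx)))
      · simp [hj.2 p hp]
    obtain ⟨g, hg⟩ := exists_toEnd_eq hfl hlv (by
      intro x hx hx0
      by_contra hne
      simp only [LinearMap.add_apply, LinearMap.smul_apply, LinearMap.sub_apply,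
        LinearMap.id_apply] at hx0
      have h1 : (1 - t) • A x = (-t) • x := by
        have : (1 - t) • A x - (-t) • x = A x + t • (x - A x) := by module
        rw [← sub_eq_zero, this, hx0]
      have ht1 : 1 - t ≠ 0 := by
        intro h
        have : t = 1 := by linear_combination -h
        subst this
        simp at h1
        exact hne h1
      have h2 : A x = (-t / (1 - t)) • x := by
        rw [div_eq_inv_mul, mul_smul, ← h1, smul_smul, inv_mul_cancel₀ ht1, one_smul]
      refine ht ⟨-t / (1 - t), ?_, ?_⟩
      · refine Module.End.hasEigenvalue_of_hasEigenvector (x := (⟨x, hx⟩ : stdSub (cst n j)))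
          ⟨Module.End.mem_eigenspace_iff.2 (Subtype.ext h2), fun h => hne (congrArg Subtype.val h)⟩
      · simp only
        field_simp
        ring)
    rw [Polynomial.IsRoot, ← hQ, ← hg, h g (hg ▸ hlv), map_zero]
  have hQ0 : Q = 0 := Polynomial.eq_zero_of_infinite_isRoot Q
    (hT.infinite_compl.mono fun t ht => hroot t ht)
  have := hQ 0
  rw [hQ0] at this
  simpa using this

/-- The monoid of flag preserving endomorphisms of the standard representation that lie in some
finite level. Its unit group is `𝐆`. -/
def flagEnd (n : ℕ) : Submonoid (Module.End ℂ (VInf n)) where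
  carrier := {A | PreservesFlag A ∧ ∃ j, IsLevel j A}
  one_mem' := ⟨PreservesFlag.id, 0, IsLevel.id 0⟩
  mul_mem' := by
    rintro A B ⟨hA, j, hj⟩ ⟨hB, k, hk⟩
    exact ⟨hA.comp hB, max j k, (hj.mono (le_max_left _ _)).comp (hk.mono (le_max_right _ _))⟩

/-- `α` is an extension of the action of `𝐆` on `V` to the monoid of endomorphisms that is
polynomial on each finite level. (The endomorphisms of level `j` form an affine space of finite
dimension, on which the linear functionals are the affine functions of the finitely many matrix
entries; so polynomial means polynomial in the matrix entries.) -/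
structure IsEndAction {n : ℕ} (V : Rep.{0} ℂ (G n)) (α : flagEnd n →* Module.End ℂ V) : Prop where
  extends_action : ∀ (g : G n) (A : flagEnd n), (A : Module.End ℂ (VInf n)) = toEnd g →
    α A = V.ρ g
  polynomial : ∀ (j : ℕ) (x : V), ∃ p : Module.End ℂ (VInf n) → V, IsPolyMap p ∧
    ∀ A : flagEnd n, IsLevel j (A : Module.End ℂ (VInf n)) → α A x = p A

/-- On each finite level the orbit maps `g ↦ g x` are polynomial. -/
def HasPolyOrbits {n : ℕ} (V : Rep.{0} ℂ (G n)) : Prop :=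
  ∀ (j : ℕ) (x : V), ∃ p : Module.End ℂ (VInf n) → V, IsPolyMap p ∧
    ∀ g : G n, IsLevel j (toEnd g) → p (toEnd g) = V.ρ g x

namespace HasPolyOrbits

variable {n : ℕ} {V W : Rep.{0} ℂ (G n)}

theorem of_mono (f : V ⟶ W) [hf : Mono f] (h : HasPolyOrbits W) : HasPolyOrbits V := by
  intro j x
  obtain ⟨p, hp, hpg⟩ := h j (f.hom x)
  obtain ⟨r, hr⟩ := LinearMap.exists_leftInverse_of_injective f.hom.toLinearMap
    (LinearMap.ker_eq_bot.2 ((Rep.mono_iff_injective f).1 hf))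
  refine ⟨fun A => r (p A), hp.map r, fun g hg => ?_⟩
  simp only
  rw [hpg g hg, ← Rep.hom_comm_apply]
  exact LinearMap.congr_fun hr _

theorem of_epi (f : V ⟶ W) [hf : Epi f] (h : HasPolyOrbits V) : HasPolyOrbits W := by
  intro j y
  obtain ⟨x, rfl⟩ := (Rep.epi_iff_surjective f).1 hf y
  obtain ⟨p, hp, hpg⟩ := h j x
  refine ⟨fun A => f.hom (p A), hp.map f.hom.toLinearMap, fun g hg => ?_⟩
  simp only
  rw [hpg g hg, Rep.hom_comm_apply]

theorem unit : HasPolyOrbits (𝟙_ (Rep.{0} ℂ (G n))) :=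
  fun _ x => ⟨fun _ => x, IsPolyMap.const x, fun _ _ => rfl⟩

theorem tensor (hV : HasPolyOrbits V) (hW : HasPolyOrbits W) : HasPolyOrbits (V ⊗ W) := by
  intro j x
  change TensorProduct ℂ V W at x
  induction x using TensorProduct.induction_on with
  | zero => exact ⟨fun _ => 0, IsPolyMap.const _, fun g _ => (map_zero _).symm⟩
  | tmul x y =>
    obtain ⟨p, hp, hpg⟩ := hV j x
    obtain ⟨q, hq, hqg⟩ := hW j y
    refine ⟨fun A => TensorProduct.tmul ℂ (p A) (q A), hp.tmul hq, fun g hg => ?_⟩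
    simp only
    rw [hpg g hg, hqg g hg]
    rfl
  | add x y hx hy =>
    obtain ⟨p, hp, hpg⟩ := hx
    obtain ⟨q, hq, hqg⟩ := hy
    refine ⟨p + q, hp.add hq, fun g hg => ?_⟩
    rw [Pi.add_apply, hpg g hg, hqg g hg]
    exact (map_add ((V ⊗ W).ρ g) x y).symm

theorem std_aux (j : ℕ) (x : VInf n) : ∃ p : Module.End ℂ (VInf n) → VInf n, IsPolyMap p ∧
    ∀ g : G n, IsLevel j (toEnd g) → p (toEnd g) = toEnd g x := by
  classical
  let S : Finset (Fin n × ℕ) := (finite_stdSub_index (cst n j)).toFinset ∪ x.support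
  refine ⟨fun A => ∑ s ∈ S, (A x s) • (Finsupp.single s 1 : VInf n), ?_, fun g hg => ?_⟩
  · have : (fun A : Module.End ℂ (VInf n) => ∑ s ∈ S, (A x s) • (Finsupp.single s 1 : VInf n)) =
        ∑ s ∈ S, fun A : Module.End ℂ (VInf n) => (A x s) • (Finsupp.single s 1 : VInf n) := by
      funext A; simp
    rw [this]
    refine IsPolyMap.sum S fun s _ => ?_
    exact IsPolyMap.linear ((Finsupp.lapply s) ∘ₗ (LinearMap.applyₗ x)) _
  · have hmem : toEnd g x ∈ Finsupp.supported ℂ ℂ (S : Set (Fin n × ℕ)) := by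
      obtain ⟨y, z, hx, hy, hz, -⟩ := split_level j x
      have h1 : stdSub (cst n j) ≤ Finsupp.supported ℂ ℂ (S : Set (Fin n × ℕ)) :=
        Finsupp.supported_mono fun p hp => by simp [S]; exact Or.inl hp
      have h2 : x ∈ Finsupp.supported ℂ ℂ (S : Set (Fin n × ℕ)) := by
        rw [Finsupp.mem_supported]; simp [S]
      have h3 : toEnd g x = toEnd g y + (x - y) := by
        rw [hx, map_add, hg.fix hz]; abel
      rw [h3]
      exact add_mem (h1 (hg.1 y hy)) (sub_mem h2 (h1 hy))
    rw [Finsupp.mem_supported] at hmem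
    conv_rhs => rw [← Finsupp.sum_single (toEnd g x)]
    rw [Finsupp.sum_of_support_subset _ (Finset.coe_subset.1 hmem) _ (by simp)]
    exact Finset.sum_congr rfl fun s _ => by simp

theorem std : HasPolyOrbits (stdRep n) := fun j x => std_aux j x

theorem tensorPow (h : HasPolyOrbits V) : ∀ k, HasPolyOrbits (tensorPow V k)
  | 0 => unit
  | k + 1 => (tensorPow h k).tensor h

open Limits in
theorem biproduct {k : ℕ} (X : Fin k → Rep.{0} ℂ (G n)) (h : ∀ i, HasPolyOrbits (X i)) :
    HasPolyOrbits (⨁ X) := by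
  intro j x
  choose p hp hpg using fun i => h i j ((biproduct.π X i).hom x)
  refine ⟨∑ i, fun A => (biproduct.ι X i).hom (p i A),
    IsPolyMap.sum _ fun i _ => (hp i).map (biproduct.ι X i).hom.toLinearMap, fun g hg => ?_⟩
  rw [Finset.sum_apply]
  have htot : ∀ y : (⨁ X : Rep.{0} ℂ (G n)),
      ∑ i, (biproduct.ι X i).hom ((biproduct.π X i).hom y) = y := by
    intro y
    have h1 := congrArg (fun f => f.hom y) (biproduct.total (f := X))
    have h2 := congrArg (fun f => f.hom y)
      ((forget₂ (Rep.{0} ℂ (G n)) (ModuleCat ℂ)).map_sum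
        (fun i => biproduct.π X i ≫ biproduct.ι X i) Finset.univ)
    have h3 : (∑ i, (forget₂ (Rep.{0} ℂ (G n)) (ModuleCat ℂ)).map
        (biproduct.π X i ≫ biproduct.ι X i)).hom y =
        ∑ i, (biproduct.ι X i).hom ((biproduct.π X i).hom y) := by
      rw [ModuleCat.hom_sum, LinearMap.sum_apply]
      rfl
    rw [← h3]
    exact h2.symm.trans h1
  refine Eq.trans ?_ (htot ((⨁ X : Rep.{0} ℂ (G n)).ρ g x))
  refine Finset.sum_congr rfl fun i _ => ?_
  rw [hpg i g hg]
  exact congrArg _ (Rep.hom_comm_apply (biproduct.π X i) g x).symm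

theorem of_isPolyRep (h : isPolyRep n V) : HasPolyOrbits V := by
  obtain ⟨k, a, Z, i, q, hi, hq⟩ := h
  have h1 : HasPolyOrbits Z := of_mono i (biproduct _ fun i => tensorPow std (a i))
  exact of_epi q h1

end HasPolyOrbits

theorem endAction_unique {n : ℕ} {V : Rep.{0} ℂ (G n)} {α β : flagEnd n →* Module.End ℂ V}
    (hα : IsEndAction V α) (hβ : IsEndAction V β) : α = β := by
  ext A x
  obtain ⟨hfl, j, hj⟩ := A.2
  obtain ⟨p, hp, hpA⟩ := hα.polynomial j x
  obtain ⟨q, hq, hqA⟩ := hβ.polynomial j x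
  have hG : ∀ g : G n, toEnd g ∈ flagEnd n := fun g => ⟨preservesFlag_toEnd g, exists_level g⟩
  rw [hpA A hj, hqA A hj, ← sub_eq_zero]
  refine poly_vanish (hp.sub hq) (fun g hg => ?_) hfl hj
  rw [Pi.sub_apply, ← hpA ⟨toEnd g, hG g⟩ hg, ← hqA ⟨toEnd g, hG g⟩ hg,
    hα.extends_action g _ rfl, hβ.extends_action g _ rfl, sub_self]

theorem exists_endAction {n : ℕ} {V : Rep.{0} ℂ (G n)} (h : HasPolyOrbits V) :
    ∃ α : flagEnd n →* Module.End ℂ V, IsEndAction V α := by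
  choose p hp hpg using h
  let lv : flagEnd n → ℕ := fun A => A.2.2.choose
  have hlv : ∀ A : flagEnd n, IsLevel (lv A) (A : Module.End ℂ (VInf n)) :=
    fun A => A.2.2.choose_spec
  have key : ∀ (A : flagEnd n) (k : ℕ) (x : V) (q : Module.End ℂ (VInf n) → V),
      IsLevel k (A : Module.End ℂ (VInf n)) → IsPolyMap q →
      (∀ g : G n, IsLevel k (toEnd g) → q (toEnd g) = V.ρ g x) → p (lv A) x A = q A := by
    intro A k x q hk hq hqg
    rw [← sub_eq_zero]
    rcases le_total (lv A) k with hle | hle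
    · refine poly_vanish ((hp (lv A) x).sub hq) (fun g hg => ?_) A.2.1 (hlv A)
      rw [Pi.sub_apply, hpg _ _ g hg, hqg g (hg.mono hle), sub_self]
    · refine poly_vanish ((hp (lv A) x).sub hq) (fun g hg => ?_) A.2.1 hk
      rw [Pi.sub_apply, hpg _ _ g (hg.mono hle), hqg g hg, sub_self]
  have key' : ∀ (A : flagEnd n) (k : ℕ) (x : V), IsLevel k (A : Module.End ℂ (VInf n)) →
      p (lv A) x A = p k x A := fun A k x hk => key A k x (p k x) hk (hp k x) (hpg k x)
  let act : flagEnd n → Module.End ℂ V := fun A =>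
    { toFun := fun x => p (lv A) x A
      map_add' := fun x y => key A (lv A) (x + y) (p (lv A) x + p (lv A) y) (hlv A)
        ((hp _ _).add (hp _ _)) fun g hg => by
          rw [Pi.add_apply, hpg _ _ g hg, hpg _ _ g hg, map_add]
      map_smul' := fun c x => key A (lv A) (c • x) (c • p (lv A) x) (hlv A)
        ((hp _ _).smul c) fun g hg => by
          rw [Pi.smul_apply, hpg _ _ g hg, map_smul] }
  have act_apply : ∀ (A : flagEnd n) (k : ℕ) (x : V), IsLevel k (A : Module.End ℂ (VInf n)) →
      act A x = p k x A := key'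
  have act_g : ∀ (g : G n) (A : flagEnd n), (A : Module.End ℂ (VInf n)) = toEnd g →
      act A = V.ρ g := by
    intro g A hA
    ext x
    obtain ⟨k, hk⟩ := exists_level g
    rw [act_apply A k x (hA ▸ hk), hA, hpg k x g hk]
  refine ⟨⟨⟨act, ?_⟩, ?_⟩, ⟨act_g, fun j x => ⟨p j x, hp j x, fun A hA => act_apply A j x hA⟩⟩⟩
  · rw [act_g 1 1 rfl, map_one]
  · intro B A
    ext x
    obtain ⟨-, j, hj⟩ := A.2
    obtain ⟨-, k, hk⟩ := B.2
    have hA := hj.mono (le_max_left j k)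
    have hB := hk.mono (le_max_right j k)
    set l := max j k
    have claim : ∀ (g : G n), IsLevel l (toEnd g) → ∀ C : Module.End ℂ (VInf n),
        PreservesFlag C → IsLevel l C → V.ρ g (p l x C) = p l x (toEnd g ∘ₗ C) := by
      intro g hg C hCf hC
      rw [← sub_eq_zero]
      have e1 : IsPolyMap (fun C : Module.End ℂ (VInf n) => p l x (toEnd g ∘ₗ C)) :=
        (hp l x).precomp (E' := Module.End ℂ (VInf n))
          (LinearMap.llcomp ℂ (VInf n) (VInf n) (VInf n) (toEnd g))
      have e2 : IsPolyMap (fun C : Module.End ℂ (VInf n) => V.ρ g (p l x C)) :=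
        (hp l x).map (V.ρ g)
      refine poly_vanish (p := fun C => V.ρ g (p l x C) - p l x (toEnd g ∘ₗ C))
        (e2.sub e1) (fun g' hg' => ?_) hCf hC
      have h1 : toEnd g ∘ₗ toEnd g' = toEnd (g * g') := rfl
      rw [h1, hpg l x g' hg', hpg l x (g * g') (h1 ▸ hg.comp hg'), map_mul, Module.End.mul_apply,
        sub_self]
    have h2 : p l (p l x A) B = p l x ((B : Module.End ℂ (VInf n)) ∘ₗ A) := by
      rw [← sub_eq_zero]
      have e1 : IsPolyMap (fun C : Module.End ℂ (VInf n) =>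
          p l x (C ∘ₗ (A : Module.End ℂ (VInf n)))) :=
        (hp l x).precomp (E' := Module.End ℂ (VInf n))
          (LinearMap.lcomp ℂ (VInf n) (A : Module.End ℂ (VInf n)))
      refine poly_vanish (p := fun C => p l (p l x A) C - p l x (C ∘ₗ A))
        ((hp l _).sub e1)
        (fun g hg => ?_) B.2.1 hB
      rw [hpg l _ g hg, claim g hg A A.2.1 hA, sub_self]
    change act (B * A) x = act B (act A x)
    rw [act_apply A l x hA, act_apply B l _ hB, h2, act_apply (B * A) l x (hB.comp hA)]
    rfl

/-- The action of the monoid of endomorphisms on a polynomial representation, obtained from the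
polynomial entries of the action of `𝐆`; it is the unique one with `IsEndAction`. -/
def endAction {n : ℕ} (V : PolyRep n) : flagEnd n →* Module.End ℂ V.obj :=
  (exists_endAction (HasPolyOrbits.of_isPolyRep V.property)).choose

theorem endAction_spec {n : ℕ} (V : PolyRep n) : IsEndAction V.obj (endAction V) :=
  (exists_endAction (HasPolyOrbits.of_isPolyRep V.property)).choose_spec

theorem endAction_toEnd {n : ℕ} (V : PolyRep n) (g : G n) (A : flagEnd n)
    (hA : (A : Module.End ℂ (VInf n)) = toEnd g) (x : V.obj) :
    endAction V A x = V.obj.ρ g x := by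
  rw [(endAction_spec V).extends_action g A hA]

/-- Morphisms of polynomial representations commute with the action of the endomorphisms. -/
theorem endAction_natural {n : ℕ} {V W : PolyRep n} (f : V ⟶ W) (A : flagEnd n) (x : V.obj) :
    f.hom.hom (endAction V A x) = endAction W A (f.hom.hom x) := by
  obtain ⟨hfl, j, hj⟩ := A.2
  obtain ⟨p, hp, hpA⟩ := (endAction_spec V).polynomial j x
  obtain ⟨q, hq, hqA⟩ := (endAction_spec W).polynomial j (f.hom.hom x)
  have hG : ∀ g : G n, toEnd g ∈ flagEnd n := fun g => ⟨preservesFlag_toEnd g, exists_level g⟩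
  rw [hpA A hj, hqA A hj, ← sub_eq_zero]
  refine poly_vanish (p := fun A => f.hom.hom (p A) - q A)
    ((hp.map f.hom.hom.toLinearMap).sub hq) (fun g hg => ?_) hfl hj
  rw [← hpA ⟨toEnd g, hG g⟩ hg, ← hqA ⟨toEnd g, hG g⟩ hg, endAction_toEnd V g _ rfl,
    endAction_toEnd W g _ rfl, Rep.hom_comm_apply, sub_self]

/-! ### The functor of invariants -/

/-- The subgroup `H_a` of `𝐆`: the block diagonal matrices whose `i`-th diagonal block fixes the
first `aᵢ` basis vectors and maps the span of the remaining basis vectors to itself. -/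
def H {n : ℕ} (a : Fin n → ℕ) : Subgroup (G n) where
  carrier := {g | (∀ x ∈ stdSub a, toEnd g x = x) ∧
    ∀ i : Fin n, (Finsupp.supported ℂ ℂ {p : Fin n × ℕ | p.1 = i ∧ a i ≤ p.2}).map (toEnd g) =
      Finsupp.supported ℂ ℂ {p : Fin n × ℕ | p.1 = i ∧ a i ≤ p.2}}
  one_mem' := ⟨fun _ _ => rfl, fun _ => Submodule.map_id _⟩
  mul_mem' := by
    rintro g h ⟨hg, hg'⟩ ⟨hh, hh'⟩
    have e : toEnd (g * h) = toEnd g ∘ₗ toEnd h := rfl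
    refine ⟨fun x hx => ?_, fun i => ?_⟩
    · rw [e, LinearMap.comp_apply, hh x hx, hg x hx]
    · rw [e, Submodule.map_comp, hh', hg']
  inv_mem' := by
    rintro g ⟨hg, hg'⟩
    have e : toEnd g⁻¹ ∘ₗ toEnd g = LinearMap.id := by
      change toEnd (g⁻¹ * g) = _
      rw [inv_mul_cancel]; rfl
    refine ⟨fun x hx => ?_, fun i => ?_⟩
    · conv_lhs => rw [← hg x hx]
      exact LinearMap.congr_fun e x
    · conv_lhs => rw [← hg' i]
      rw [← Submodule.map_comp, e, Submodule.map_id]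

/-- The space `V^{H_a}` of invariants. -/
def invariants {n : ℕ} (V : Rep.{0} ℂ (G n)) (a : Fin n → ℕ) : Submodule ℂ V where
  carrier := {x | ∀ g ∈ H a, V.ρ g x = x}
  add_mem' := fun hx hy g hg => by rw [map_add, hx g hg, hy g hg]
  zero_mem' := fun g _ => map_zero _
  smul_mem' := fun c x hx g hg => by rw [map_smul, hx g hg]

/-- A level that contains `ℂ^a` and `ℂ^b`. -/
def lvl {n : ℕ} (a b : Fin n → ℕ) : ℕ := Finset.univ.sup a ⊔ Finset.univ.sup b

/-- The linear map `ℂ^a → ℂ^b` underlying a morphism of flags. -/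
def stdLin {n : ℕ} {a b : Fin n → ℕ} (f : stdFlag a ⟶ stdFlag b) : stdSub a →ₗ[ℂ] stdSub b :=
  f.toLin

/-- The endomorphism of the standard representation that extends a morphism `f : ℂ^a ⟶ ℂ^b`:
it kills the basis vectors of `ℂ^{(jⁿ)}` outside `ℂ^a` and fixes the basis vectors outside
`ℂ^{(jⁿ)}`, where `j` is the maximum of the entries of `a` and `b`. -/
def extendLin {n : ℕ} {a b : Fin n → ℕ} (f : stdFlag a ⟶ stdFlag b) : VInf n →ₗ[ℂ] VInf n :=
  Finsupp.linearCombination ℂ fun p : Fin n × ℕ =>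
    if h : p.2 < a p.1 then
      (stdLin f ⟨Finsupp.single p 1, single_mem_stdSub h 1⟩ : VInf n)
    else if p.2 < lvl a b then 0 else Finsupp.single p 1

theorem linMap_eqOn_stdSub {n : ℕ} {a : Fin n → ℕ} {M : Type} [AddCommGroup M] [Module ℂ M]
    {A B : VInf n →ₗ[ℂ] M}
    (h : ∀ p : Fin n × ℕ, p.2 < a p.1 → A (Finsupp.single p 1) = B (Finsupp.single p 1)) :
    ∀ x ∈ stdSub a, A x = B x := by
  intro x hx
  rw [stdSub, Finsupp.supported_eq_span_single] at hx
  induction hx using Submodule.span_induction with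
  | mem x hx => obtain ⟨p, hp, rfl⟩ := hx; exact h p hp
  | zero => simp
  | add x y _ _ hx hy => rw [map_add, map_add, hx, hy]
  | smul c x _ hx => rw [map_smul, map_smul, hx]

theorem preservesFlag_of_single {n : ℕ} {A : VInf n →ₗ[ℂ] VInf n}
    (h : ∀ i, ∀ p : Fin n × ℕ, (p.1 : ℕ) < (i : Fin (n + 1)) →
      A (Finsupp.single p 1) ∈ flagSub n i) : PreservesFlag A := by
  intro i
  change flagSub n i ≤ (flagSub n i).comap A
  conv_lhs => rw [flagSub, Finsupp.supported_eq_span_single]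
  rw [Submodule.span_le]
  rintro _ ⟨p, hp, rfl⟩
  exact h i p hp

theorem single_mem_flagSub {n : ℕ} {i : Fin (n + 1)} {p : Fin n × ℕ} (h : (p.1 : ℕ) < i) (c : ℂ) :
    Finsupp.single p c ∈ flagSub n i :=
  Finsupp.single_mem_supported ℂ c h

theorem extendLin_single {n : ℕ} {a b : Fin n → ℕ} (f : stdFlag a ⟶ stdFlag b)
    (p : Fin n × ℕ) : extendLin f (Finsupp.single p 1) =
      if h : p.2 < a p.1 then
        (stdLin f ⟨Finsupp.single p 1, single_mem_stdSub h 1⟩ : VInf n)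
      else if p.2 < lvl a b then 0 else Finsupp.single p 1 := by
  rw [extendLin, Finsupp.linearCombination_single, one_smul]

theorem extendLin_apply {n : ℕ} {a b : Fin n → ℕ} (f : stdFlag a ⟶ stdFlag b) (x : stdSub a) :
    extendLin f x = stdLin f x := by
  have hx := x.2
  obtain ⟨x, hx'⟩ := x
  let r : VInf n →ₗ[ℂ] stdSub a := Finsupp.restrictDom ℂ ℂ {p : Fin n × ℕ | p.2 < a p.1}
  have hr : ∀ y : stdSub a, r y = y := fun y =>
    LinearMap.congr_fun (Finsupp.restrictDom_comp_subtype (M := ℂ) (R := ℂ) _) y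
  have key := linMap_eqOn_stdSub (a := a) (A := extendLin f)
    (B := (stdSub b).subtype ∘ₗ stdLin f ∘ₗ r) (fun p hp => by
      rw [extendLin_single, dif_pos hp]
      have h := hr ⟨Finsupp.single p 1, single_mem_stdSub hp 1⟩
      exact (congrArg (fun y => (stdLin f y : VInf n)) h).symm) x hx
  exact key.trans (congrArg (fun y => (stdLin f y : VInf n)) (hr ⟨x, hx'⟩))

theorem le_lvl_left {n : ℕ} (a b : Fin n → ℕ) : a ≤ cst n (lvl a b) :=
  fun i => (Finset.le_sup (f := a) (Finset.mem_univ i)).trans le_sup_left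

theorem le_lvl_right {n : ℕ} (a b : Fin n → ℕ) : b ≤ cst n (lvl a b) :=
  fun i => (Finset.le_sup (f := b) (Finset.mem_univ i)).trans le_sup_right

theorem extendLin_mem {n : ℕ} {a b : Fin n → ℕ} (f : stdFlag a ⟶ stdFlag b) :
    extendLin f ∈ flagEnd n := by
  refine ⟨preservesFlag_of_single fun i p hp => ?_, lvl a b, fun x hx => ?_, fun p hp => ?_⟩
  · rw [extendLin_single]
    split_ifs with h1 h2
    · exact f.map_fil i _ (single_mem_flagSub hp 1)
    · exact zero_mem _
    · exact single_mem_flagSub hp 1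
  · refine stdSub_induction (W := (stdSub (cst n (lvl a b))).comap (extendLin f))
      (fun p hp => ?_) hx
    rw [Submodule.mem_comap, extendLin_single]
    split_ifs with h1
    · exact stdSub_mono (le_lvl_right a b) (stdLin f _).2
    · exact zero_mem _
  · rw [extendLin_single, dif_neg (fun h => absurd (h.trans_le (le_lvl_left a b p.1)) hp.not_gt),
      if_neg hp.not_gt]

/-- The element of the monoid of endomorphisms extending a morphism `ℂ^a ⟶ ℂ^b`. -/
def extend {n : ℕ} {a b : Fin n → ℕ} (f : stdFlag a ⟶ stdFlag b) : flagEnd n :=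
  ⟨extendLin f, extendLin_mem f⟩

/-- The diagonal endomorphism that multiplies by `t` the basis vectors of `ℂ^{(jⁿ)}` outside
`ℂ^a`, and fixes all others. -/
def diagLin {n : ℕ} (a : Fin n → ℕ) (j : ℕ) (t : ℂ) : VInf n →ₗ[ℂ] VInf n :=
  Finsupp.linearCombination ℂ fun p : Fin n × ℕ =>
    (if p.2 < a p.1 then 1 else if p.2 < j then t else 1 : ℂ) • Finsupp.single p (1 : ℂ)

theorem diagLin_single {n : ℕ} (a : Fin n → ℕ) (j : ℕ) (t : ℂ) (p : Fin n × ℕ) :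
    diagLin a j t (Finsupp.single p 1) =
      (if p.2 < a p.1 then 1 else if p.2 < j then t else 1 : ℂ) • Finsupp.single p (1 : ℂ) := by
  rw [diagLin, Finsupp.linearCombination_single, one_smul]

theorem linMap_ext {n : ℕ} {M : Type} [AddCommGroup M] [Module ℂ M] {A B : VInf n →ₗ[ℂ] M}
    (h : ∀ p : Fin n × ℕ, A (Finsupp.single p 1) = B (Finsupp.single p 1)) : A = B :=
  Finsupp.lhom_ext' fun p => LinearMap.ext_ring (h p)

theorem diagLin_level {n : ℕ} {a : Fin n → ℕ} {j : ℕ} (t : ℂ) :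
    IsLevel j (diagLin a j t) := by
  refine ⟨fun x hx => ?_, fun p hp => ?_⟩
  · refine stdSub_induction (W := (stdSub (cst n j)).comap (diagLin a j t)) (fun p hp => ?_) hx
    rw [Submodule.mem_comap, diagLin_single]
    exact Submodule.smul_mem _ _ (single_mem_stdSub hp 1)
  · rw [diagLin_single]
    simp [hp.not_gt]

theorem diagLin_flag {n : ℕ} (a : Fin n → ℕ) (j : ℕ) (t : ℂ) : PreservesFlag (diagLin a j t) :=
  preservesFlag_of_single fun i p hp => by
    rw [diagLin_single]
    exact Submodule.smul_mem _ _ (single_mem_flagSub hp 1)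

theorem diagLin_mul_inv {n : ℕ} (a : Fin n → ℕ) (j : ℕ) {t : ℂ} (ht : t ≠ 0) :
    diagLin a j t ∘ₗ diagLin a j t⁻¹ = LinearMap.id := by
  refine linMap_ext fun p => ?_
  rw [LinearMap.comp_apply, diagLin_single, map_smul, diagLin_single, smul_smul]
  split_ifs <;> simp [ht]

/-- For `t ≠ 0`, the diagonal endomorphism belongs to `H_a`. -/
theorem diagLin_H {n : ℕ} (a : Fin n → ℕ) (j : ℕ) {t : ℂ} (ht : t ≠ 0) :
    ∃ g ∈ H a, toEnd g = diagLin a j t := by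
  obtain ⟨g, hg⟩ := exists_toEnd_eq (diagLin_flag a j t) (diagLin_level (a := a) (j := j) t)
    (fun x _ hx => by
      have h := LinearMap.congr_fun (diagLin_mul_inv a j (inv_ne_zero ht)) x
      rw [inv_inv, LinearMap.comp_apply, hx, map_zero] at h
      exact h.symm)
  have hle : ∀ (t : ℂ) (i : Fin n),
      (Finsupp.supported ℂ ℂ {p : Fin n × ℕ | p.1 = i ∧ a i ≤ p.2}).map (diagLin a j t) ≤
        Finsupp.supported ℂ ℂ {p : Fin n × ℕ | p.1 = i ∧ a i ≤ p.2} := by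
    intro t i
    rw [Submodule.map_le_iff_le_comap]
    conv_lhs => rw [Finsupp.supported_eq_span_single]
    rw [Submodule.span_le]
    rintro _ ⟨p, hp, rfl⟩
    change diagLin a j t _ ∈ Finsupp.supported ℂ ℂ {p : Fin n × ℕ | p.1 = i ∧ a i ≤ p.2}
    rw [diagLin_single]
    exact Submodule.smul_mem _ _ (Finsupp.single_mem_supported ℂ 1 hp)
  refine ⟨g, ⟨fun x hx => ?_, fun i => ?_⟩, hg⟩
  · rw [hg]
    refine linMap_eqOn_stdSub (B := LinearMap.id) (fun p hp => ?_) x hx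
    rw [diagLin_single, if_pos hp, one_smul]
    rfl
  · rw [hg]
    refine le_antisymm (hle t i) ?_
    conv_lhs => rw [← Submodule.map_id (Finsupp.supported ℂ ℂ {p : Fin n × ℕ | p.1 = i ∧ a i ≤ p.2}),
      ← diagLin_mul_inv a j ht, Submodule.map_comp]
    exact Submodule.map_mono (hle t⁻¹ i)

/-- The projection to `ℂ^a` acts as the identity on the invariants of `H_a`. -/
theorem endAction_proj {n : ℕ} (V : PolyRep n) {a : Fin n → ℕ} (j : ℕ)
    {x : V.obj} (hx : x ∈ invariants V.obj a) (A : flagEnd n)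
    (hA : (A : Module.End ℂ (VInf n)) = diagLin a j 0) : endAction V A x = x := by
  obtain ⟨p, hp, hpA⟩ := (endAction_spec V).polynomial j x
  rw [← sub_eq_zero, ← Module.forall_dual_apply_eq_zero_iff ℂ]
  intro φ
  have hline : ∀ t : ℂ, diagLin a j 0 + t • (LinearMap.id - diagLin a j 0) = diagLin a j t := by
    intro t
    refine linMap_ext fun q => ?_
    simp only [LinearMap.add_apply, LinearMap.smul_apply, LinearMap.sub_apply, LinearMap.id_apply,
      diagLin_single]
    split_ifs <;> simp
  obtain ⟨Q, hQ⟩ := hp.exists_line φ (diagLin a j 0) (LinearMap.id - diagLin a j 0)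
  have hroot : ∀ t ∈ ({0} : Set ℂ)ᶜ, (Q - Polynomial.C (φ x)).IsRoot t := by
    intro t ht
    obtain ⟨g, hgH, hg⟩ := diagLin_H a j (t := t) ht
    have hG : toEnd g ∈ flagEnd n := ⟨preservesFlag_toEnd g, exists_level g⟩
    have hl : IsLevel j (toEnd g) := by rw [hg]; exact diagLin_level t
    have h1 := hpA ⟨toEnd g, hG⟩ hl
    rw [endAction_toEnd V g _ rfl, hx g hgH] at h1
    rw [Polynomial.IsRoot, Polynomial.eval_sub, Polynomial.eval_C, ← hQ, hline, ← hg, ← h1,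
      sub_self]
  have hQ0 : Q - Polynomial.C (φ x) = 0 := Polynomial.eq_zero_of_infinite_isRoot _
    ((Set.finite_singleton (0 : ℂ)).infinite_compl.mono fun t ht => hroot t ht)
  have h0 := hQ 0
  rw [sub_eq_zero.1 hQ0, Polynomial.eval_C, hline, ← hA,
    ← hpA A (by rw [hA]; exact diagLin_level 0)] at h0
  rw [map_sub, h0, sub_self]

/-- The action on the invariants of `H_a` depends only on the restriction to `ℂ^a`. -/
theorem endAction_congr {n : ℕ} (V : PolyRep n) {a : Fin n → ℕ}
    {x : V.obj} (hx : x ∈ invariants V.obj a) (A B : flagEnd n)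
    (hAB : ∀ y ∈ stdSub a, (A : Module.End ℂ (VInf n)) y = (B : Module.End ℂ (VInf n)) y) :
    endAction V A x = endAction V B x := by
  obtain ⟨-, j, hj⟩ := A.2
  obtain ⟨-, k, hk⟩ := B.2
  have hj := hj.mono (le_max_left j k)
  have hk := hk.mono (le_max_right j k)
  set l := max j k
  let P : flagEnd n := ⟨diagLin a l 0, diagLin_flag a l 0, l, diagLin_level 0⟩
  have hP : endAction V P x = x := endAction_proj V l hx P rfl
  have hcomp : A * P = B * P := by
    refine Subtype.ext (linMap_ext fun p => ?_)
    change (A : Module.End ℂ (VInf n)) (diagLin a l 0 _) =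
      (B : Module.End ℂ (VInf n)) (diagLin a l 0 _)
    rw [diagLin_single, map_smul, map_smul]
    split_ifs with h1 h2
    · rw [hAB _ (single_mem_stdSub h1 1)]
    · rw [zero_smul, zero_smul]
    · rw [hj.2 p (not_lt.1 h2), hk.2 p (not_lt.1 h2)]
  calc endAction V A x = endAction V (A * P) x := by
        rw [map_mul, Module.End.mul_apply, hP]
    _ = endAction V B x := by rw [hcomp, map_mul, Module.End.mul_apply, hP]

theorem endAction_extend_mem {n : ℕ} (V : PolyRep n) {a b : Fin n → ℕ}
    (f : stdFlag a ⟶ stdFlag b) {x : V.obj} (hx : x ∈ invariants V.obj a) :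
    endAction V (extend f) x ∈ invariants V.obj b := by
  intro g hg
  have hG : toEnd g ∈ flagEnd n := ⟨preservesFlag_toEnd g, exists_level g⟩
  rw [← endAction_toEnd V g ⟨toEnd g, hG⟩ rfl, ← Module.End.mul_apply, ← map_mul]
  refine endAction_congr V hx _ _ fun y hy => ?_
  change toEnd g (extendLin f y) = extendLin f y
  rw [extendLin_apply f ⟨y, hy⟩]
  exact hg.1 _ (stdLin f _).2

/-- The category of the standard flags `ℂ^a`, a full subcategory of the category of flags. -/
abbrev StdFlag (n : ℕ) := InducedCategory (FlagCat n) (fun a : Fin n → ℕ => stdFlag a)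

/-- The inclusion of the standard flags into all flags. -/
abbrev stdIncFunctor (n : ℕ) : StdFlag n ⥤ FlagCat n := inducedFunctor _

/-- The functor `V ↦ (ℂ^a ↦ V^{H_a})` on polynomial representations; a morphism `f : ℂ^a ⟶ ℂ^b`
acts on invariants through an endomorphism of the standard representation that extends `f`. -/
def invFunctor (n : ℕ) : PolyRep n ⥤ (StdFlag n ⥤ ModuleCat ℂ) where
  obj V :=
    { obj := fun a => ModuleCat.of ℂ (invariants V.obj a)
      map := fun {a b} f => ModuleCat.ofHom
        ((endAction V (extend f.hom)).restrict fun _ hx => endAction_extend_mem V f.hom hx)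
      map_id := fun a => by
        ext x
        change endAction V (extend (𝟙 (stdFlag a))) x = x
        refine (endAction_congr V x.2 _ 1 fun y hy => ?_).trans ?_
        · exact extendLin_apply (𝟙 (stdFlag a)) ⟨y, hy⟩
        · rw [map_one]; rfl
      map_comp := fun {a b c} f g => by
        ext x
        change endAction V (extend (f.hom ≫ g.hom)) x =
          endAction V (extend g.hom) (endAction V (extend f.hom) x)
        rw [← Module.End.mul_apply, ← map_mul]
        refine endAction_congr V x.2 _ _ fun y hy => ?_
        change extendLin (f.hom ≫ g.hom) y = extendLin g.hom (extendLin f.hom y)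
        rw [extendLin_apply (f.hom ≫ g.hom) ⟨y, hy⟩, extendLin_apply f.hom ⟨y, hy⟩]
        exact (extendLin_apply g.hom _).symm }
  map {V W} φ :=
    { app := fun a => ModuleCat.ofHom (φ.hom.hom.toLinearMap.restrict
        (p := invariants V.obj a) (q := invariants W.obj a) fun x hx g hg => by
          change W.obj.ρ g (φ.hom.hom x) = φ.hom.hom x
          rw [← Rep.hom_comm_apply, hx g hg])
      naturality := fun a b f => by
        ext x
        exact endAction_natural φ (extend f.hom) x }
  map_id V := rfl
  map_comp φ ψ := rfl

/-- The restriction of a polynomial functor to the standard flags. -/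
def restrictStd (n : ℕ) : PolyFunctor n ⥤ (StdFlag n ⥤ ModuleCat ℂ) :=
  (isPolyFunctor n).ι ⋙ (Functor.whiskeringLeft _ _ _).obj (stdIncFunctor n) ⋙
    (Functor.whiskeringRight _ _ _).obj (forget₂ (FGModuleCat ℂ) (ModuleCat ℂ))

/-- The functor `Φ`: `F ↦ lim F(ℂ^{(jⁿ)})` from polynomial functors to polynomial representations,
for a proof `h` that the direct limits are polynomial. -/
abbrev Phi (n : ℕ) (h : ∀ F : PolyFunctor n, isPolyRep n ((limFunctor n).obj F.obj)) :
    PolyFunctor n ⥤ PolyRep n :=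
  (isPolyRep n).lift ((isPolyFunctor n).ι ⋙ limFunctor n) h

/-- The canonical map `F(ℂ^{(jⁿ)}) → Φ(F)`. -/
def toPhi {n : ℕ} (h : ∀ F : PolyFunctor n, isPolyRep n ((limFunctor n).obj F.obj))
    (F : PolyFunctor n) (j : ℕ) :
    (F.obj.obj (stdFlag (cst n j))).obj →ₗ[ℂ] ((Phi n h).obj F).obj :=
  limOf F.obj j

/-- For a functor `Ψ` with an identification `θ` of `Ψ(V)(ℂ^a)` with `V^{H_a}`, the resulting map
`Ψ(V)(ℂ^a) → V`. -/
def fromPsi {n : ℕ} {Ψ : PolyRep n ⥤ PolyFunctor n} (θ : Ψ ⋙ restrictStd n ≅ invFunctor n)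
    (V : PolyRep n) (a : Fin n → ℕ) :
    ((Ψ.obj V).obj.obj (stdFlag a)).obj →ₗ[ℂ] V.obj :=
  (invariants V.obj a).subtype ∘ₗ ((θ.hom.app V).app a).hom

end

end FlagSchur

open FlagSchur

namespace FlagSchur

noncomputable section

/-! ### Values of functors on the standard flags -/

/-! The plan is to show that `Φ` is fully faithful and essentially surjective, to take `Ψ` to be its
inverse, and to identify the values of `Ψ` on standard flags afterwards.

The inclusions `ℂ^a ⊆ ℂ^{(kⁿ)}` are split by coordinate projections, so every functor turns the
transition maps of the direct limit into injections, and the limit is an increasing union of the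
values `F(ℂ^{(jⁿ)})`. Hence `Φ` preserves monomorphisms and epimorphisms and commutes with tensor
products. It sends the forgetful functor to the standard representation, so a presentation of `F` as
a subquotient of tensor powers becomes one of `Φ(F)` (`isPolyRep_lim`).

The bridge between functors and representations is the monoid `flagEnd n`. It acts on the limit by
functoriality of `F` (`limEnd`), and for polynomial `F` this action is polynomial on each level.
Since the invertible endomorphisms are Zariski dense, it coincides with the extension of the
`𝐆`-action (`endAction_lim`). Two consequences follow. First, `F(ℂ^a)` is the space of
`H_a`-invariants of `Φ(F)` (`toInv_bijective`): elements of `H_a` restrict to the identity of `ℂ^a`;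
conversely an invariant vector is fixed by the projection to `ℂ^a`, a degeneration of diagonal
elements of `H_a`, and therefore comes from `F(ℂ^a)`. Second, under this identification `F(f)` is
the action of any endomorphism extending `f`.

A `𝐆`-equivariant map between limits is automatically equivariant for the monoid, so it induces maps
on invariants that are natural in the standard flags. Every flag is a retract of some `ℂ^{(dⁿ)}`
(`exists_retract`), which extends such maps uniquely to all flags: `Φ` is full and faithful. For
essential surjectivity, a subquotient of `⨁ 𝐕^{⊗aᵢ} = Φ(P)` is cut out by two subspaces stable under
the monoid; pulling them back to the values of `P` gives two subfunctors, and the corresponding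
subquotient of `P` has the required limit.

The tensor structure of `Φ` comes from the evident map from the limit of `F ⊗ F'` to the tensor
product of the limits, which is invertible. `Ψ` receives the mate of this structure under the
adjunction, so the adjunction is monoidal, and the formulas for `Ψ` on pure tensors follow from the
compatibility of the counit with tensor products. -/

theorem diagLin_maps {n : ℕ} (a : Fin n → ℕ) (k : ℕ) :
    ∀ x ∈ stdSub (cst n k), diagLin a k 0 x ∈ stdSub a := by
  intro x hx
  refine stdSub_induction (W := (stdSub a).comap (diagLin a k 0)) (fun p hp => ?_) hx
  rw [Submodule.mem_comap, diagLin_single]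
  by_cases h1 : p.2 < a p.1
  · exact Submodule.smul_mem _ _ (single_mem_stdSub h1 1)
  · rw [if_neg h1, if_pos hp, zero_smul]; exact zero_mem _

theorem diagLin_apply_of_mem {n : ℕ} {a : Fin n → ℕ} (k : ℕ) (t : ℂ) {x : VInf n}
    (hx : x ∈ stdSub a) : diagLin a k t x = x :=
  linMap_eqOn_stdSub (B := LinearMap.id) (fun p hp => by
    rw [diagLin_single, if_pos hp, one_smul]; rfl) x hx

/-- The projection `ℂ^{(kⁿ)} ⟶ ℂ^a` that kills the basis vectors outside `ℂ^a`. -/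
def trunc {n : ℕ} (a : Fin n → ℕ) (k : ℕ) : stdFlag (cst n k) ⟶ stdFlag a :=
  stdHom (diagLin a k 0) (diagLin_flag a k 0) (diagLin_maps a k)

theorem stdHom_congr {n : ℕ} {a b : Fin n → ℕ} {A B : VInf n →ₗ[ℂ] VInf n}
    (hA : PreservesFlag A) (hB : PreservesFlag B) (h : ∀ x ∈ stdSub a, A x ∈ stdSub b)
    (h' : ∀ x ∈ stdSub a, B x ∈ stdSub b) (hAB : ∀ x ∈ stdSub a, A x = B x) :
    stdHom A hA h = stdHom B hB h' :=
  FlagCat.Hom.ext (LinearMap.ext fun x => Subtype.ext (hAB x.1 x.2))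

/-- This retraction makes every functor injective on the inclusions of standard flags, with no
exactness assumption on the functor. -/
theorem stdIncl_trunc {n : ℕ} {a : Fin n → ℕ} {k : ℕ} (h : a ≤ cst n k) :
    stdIncl h ≫ trunc a k = 𝟙 (stdFlag a) := by
  rw [stdIncl, trunc, stdHom_comp]
  exact stdHom_congr _ PreservesFlag.id _ (fun _ hx => hx) fun x hx =>
    diagLin_apply_of_mem k 0 hx

section Lim

variable {n : ℕ} (F : FlagFunctor n)

theorem mapLin_id (U : FlagCat n) (x : (F.obj U).obj) : mapLin F (𝟙 U) x = x := by
  simp [mapLin]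

theorem mapLin_injective_of_retract {U V : FlagCat n} {s : U ⟶ V} {r : V ⟶ U} (h : s ≫ r = 𝟙 U) :
    Function.Injective (mapLin F s) :=
  Function.LeftInverse.injective (g := mapLin F r) fun x => by rw [mapLin_comp, h, mapLin_id]

theorem mapLin_natural {F F' : FlagFunctor n} (η : F ⟶ F') {U V : FlagCat n} (f : U ⟶ V)
    (x : (F.obj U).obj) :
    (η.app V).hom.hom (mapLin F f x) = mapLin F' f ((η.app U).hom.hom x) :=
  congrArg (fun φ => φ.hom.hom x) (η.naturality f)

/-- A vector that dies in the limit already dies at a finite level, where the transition map has a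
left inverse. -/
theorem limOf_injective (j : ℕ) : Function.Injective (limOf F j) := by
  rw [injective_iff_map_eq_zero]
  intro x hx
  have : DirectedSystem (fun j : ℕ => stdVal F (cst n j))
      (fun _ _ h => mapLin F (stdIncl fun _ => h)) :=
    ⟨fun _ x => mapLin_id F _ x, fun _ _ _ _ _ x => mapLin_comp F _ _ x⟩
  obtain ⟨k, hjk, hk⟩ := Module.DirectLimit.of.zero_exact hx
  refine mapLin_injective_of_retract F (stdIncl_trunc (fun _ => hjk : cst n j ≤ cst n k)) ?_
  rw [map_zero]
  exact hk

theorem exists_limOf (z : LimSpace F) : ∃ j x, limOf F j x = z :=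
  Module.DirectLimit.exists_of z

theorem limOf_incl' {j k : ℕ} (hjk : j ≤ k) (x : stdVal F (cst n j)) :
    limOf F k (mapLin F (stdIncl (fun _ => hjk)) x) = limOf F j x :=
  limOf_incl F _ hjk x

theorem exists_limOf_le (z : LimSpace F) (i : ℕ) : ∃ j x, i ≤ j ∧ limOf F j x = z := by
  obtain ⟨j, x, rfl⟩ := exists_limOf F z
  exact ⟨max i j, _, le_max_left i j, limOf_incl' F (le_max_right i j) x⟩

variable {F} in
theorem lim_hom_ext {X : Rep.{0} ℂ (G n)} {f g : (limFunctor n).obj F ⟶ X}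
    (h : ∀ j (x : stdVal F (cst n j)), f.hom (limOf F j x) = g.hom (limOf F j x)) : f = g := by
  refine Rep.hom_ext (Representation.IntertwiningMap.toLinearMap_injective _ _
    (LinearMap.ext fun z => ?_))
  obtain ⟨j, x, rfl⟩ := exists_limOf F z
  exact h j x

theorem limFunctor_map_of {F F' : FlagFunctor n} (η : F ⟶ F') (j : ℕ) (x : stdVal F (cst n j)) :
    ((limFunctor n).map η).hom (limOf F j x) =
      limOf F' j ((η.app (stdFlag (cst n j))).hom.hom x) :=
  limMap_of η j x

end Lim

/-! ### The direct limit as a functor of tensor categories -/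

instance (n : ℕ) : (limFunctor n).Additive where
  map_add {F F'} η θ := lim_hom_ext fun j x => by
    change _ = ((limFunctor n).map η).hom (limOf F j x) + ((limFunctor n).map θ).hom (limOf F j x)
    rw [limFunctor_map_of, limFunctor_map_of, limFunctor_map_of]
    exact map_add (limOf F' j) _ _

instance (n : ℕ) : (limFunctor n).Linear ℂ where
  map_smul {F F'} η c := lim_hom_ext fun j x => by
    change _ = c • ((limFunctor n).map η).hom (limOf F j x)
    rw [limFunctor_map_of, limFunctor_map_of]
    exact map_smul (limOf F' j) c _

/-- Monomorphisms of functors are pointwise injective, and the finite levels embed in the limit, so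
the kernel can be tested at one level. -/
theorem limFunctor_map_mono {n : ℕ} {F F' : FlagFunctor n} (η : F ⟶ F') [Mono η] :
    Mono ((limFunctor n).map η) := by
  rw [Rep.mono_iff_injective]
  refine (injective_iff_map_eq_zero ((limFunctor n).map η).hom.toLinearMap).2 fun z hz => ?_
  obtain ⟨j, x, rfl⟩ := exists_limOf F z
  have h1 : limOf F' j ((η.app (stdFlag (cst n j))).hom.hom x) = 0 :=
    (limFunctor_map_of η j x).symm.trans hz
  have h2 := limOf_injective F' j (h1.trans (map_zero _).symm)
  have h3 := (fg_mono_iff _).1 ((NatTrans.mono_iff_mono_app η).1 inferInstance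
    (stdFlag (cst n j))) (h2.trans (map_zero _).symm)
  rw [h3]
  exact map_zero _

theorem limFunctor_map_epi {n : ℕ} {F F' : FlagFunctor n} (η : F ⟶ F') [Epi η] :
    Epi ((limFunctor n).map η) := by
  rw [Rep.epi_iff_surjective]
  intro z
  obtain ⟨j, x, rfl⟩ := exists_limOf F' z
  obtain ⟨y, rfl⟩ := (fg_epi_iff _).1 ((NatTrans.epi_iff_epi_app η).1 inferInstance
    (stdFlag (cst n j))) x
  exact ⟨limOf F j y, limFunctor_map_of η j y⟩

section Tensor

variable {n : ℕ}

/-- The comparison map from the limit of a tensor product to the tensor product of the limits. -/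
def limDeltaLin (F F' : FlagFunctor n) :
    LimSpace (F ⊗ F') →ₗ[ℂ] TensorProduct ℂ (LimSpace F) (LimSpace F') :=
  Module.DirectLimit.lift ℂ ℕ _ _
    (fun j => TensorProduct.map (limOf F j) (limOf F' j)) (by
      intro i j hij x
      change TensorProduct ℂ (stdVal F (cst n i)) (stdVal F' (cst n i)) at x
      change TensorProduct.map (limOf F j) (limOf F' j)
        (TensorProduct.map (mapLin F (stdIncl fun _ => hij)) (mapLin F' (stdIncl fun _ => hij)) x) =
        TensorProduct.map (limOf F i) (limOf F' i) x
      induction x using TensorProduct.induction_on with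
      | zero => simp only [map_zero]
      | tmul x y => simp only [TensorProduct.map_tmul, limOf_incl' _ hij]
      | add x y hx hy => simp only [map_add, hx, hy])

theorem limDeltaLin_of (F F' : FlagFunctor n) (j : ℕ)
    (x : TensorProduct ℂ (stdVal F (cst n j)) (stdVal F' (cst n j))) :
    limDeltaLin F F' (limOf (F ⊗ F') j x) = TensorProduct.map (limOf F j) (limOf F' j) x :=
  Module.DirectLimit.lift_of _ _ _

/-- A tensor is a finite sum of pure tensors, so all factors can be moved to one common level. -/
theorem exists_limOf_tensor (F F' : FlagFunctor n)
    (t : TensorProduct ℂ (LimSpace F) (LimSpace F')) :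
    ∃ j x, TensorProduct.map (limOf F j) (limOf F' j) x = t := by
  -- That raising the level does not change the image is the cocone property already contained in
  -- `limDeltaLin`.
  have step : ∀ {j k : ℕ} (h : j ≤ k)
      (x : TensorProduct ℂ (stdVal F (cst n j)) (stdVal F' (cst n j))),
      ∃ y, TensorProduct.map (limOf F k) (limOf F' k) y =
        TensorProduct.map (limOf F j) (limOf F' j) x := by
    intro j k h x
    refine ⟨mapLin (F ⊗ F') (stdIncl fun _ => h) x, ?_⟩
    refine (limDeltaLin_of F F' k _).symm.trans ((congrArg _ ?_).trans (limDeltaLin_of F F' j x))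
    exact limOf_incl' (F ⊗ F') h x
  induction t using TensorProduct.induction_on with
  | zero => exact ⟨0, 0, map_zero _⟩
  | tmul x y =>
    obtain ⟨j, x, rfl⟩ := exists_limOf F x
    obtain ⟨k, y, hk, rfl⟩ := exists_limOf_le F' y j
    exact ⟨k, TensorProduct.tmul ℂ (mapLin F (stdIncl fun _ => hk) x) y, by
      rw [TensorProduct.map_tmul, limOf_incl' _ hk]⟩
  | add x y hx hy =>
    obtain ⟨j, x, rfl⟩ := hx
    obtain ⟨k, y, rfl⟩ := hy
    obtain ⟨x', hx'⟩ := step (le_max_left j k) x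
    obtain ⟨y', hy'⟩ := step (le_max_right j k) y
    exact ⟨max j k, x' + y', by rw [map_add, hx', hy']⟩

/-- Injectivity rests on flatness over a field: the tensor product of the two embeddings of the
level-`j` values is again an embedding. -/
theorem limDeltaLin_bijective (F F' : FlagFunctor n) : Function.Bijective (limDeltaLin F F') := by
  constructor
  · rw [injective_iff_map_eq_zero]
    intro z hz
    obtain ⟨j, x, rfl⟩ := exists_limOf _ z
    have h : TensorProduct.map (limOf F j) (limOf F' j) x = 0 := (limDeltaLin_of F F' j x).symm.trans hz
    have h' : x = 0 := TensorProduct.map_injective_of_flat_flat _ _ (limOf_injective F j)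
      (limOf_injective F' j) (h.trans (map_zero _).symm)
    rw [h', map_zero]
  · intro t
    obtain ⟨j, x, rfl⟩ := exists_limOf_tensor F F' t
    exact ⟨limOf _ j x, limDeltaLin_of F F' j x⟩

/-- The comparison morphism from the limit of a tensor product to the tensor product of the
limits. -/
def limDelta (F F' : FlagFunctor n) :
    (limFunctor n).obj (F ⊗ F') ⟶ (limFunctor n).obj F ⊗ (limFunctor n).obj F' :=
  Rep.ofHom
    { toLinearMap := limDeltaLin F F'
      isIntertwining' := fun g => by
        refine LinearMap.ext fun z => ?_
        obtain ⟨j, x, rfl⟩ := exists_limOf _ z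
        obtain ⟨l, hl⟩ := exists_level g
        have h1 := hl.maps (le_max_left j l) (le_max_right j l)
        change limDeltaLin F F' (limAct _ g (limOf _ j x)) =
          TensorProduct.map (limAct F g) (limAct F' g) (limDeltaLin F F' (limOf _ j x))
        rw [limAct_of _ g h1]
        refine (limDeltaLin_of _ _ _ _).trans (Eq.trans ?_
          (congrArg (TensorProduct.map (limAct F g) (limAct F' g)) (limDeltaLin_of F F' j x).symm))
        change TensorProduct ℂ (stdVal F (cst n j)) (stdVal F' (cst n j)) at x
        change TensorProduct.map _ _ (TensorProduct.map (mapLin F _) (mapLin F' _) x) = _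
        induction x using TensorProduct.induction_on with
        | zero => simp only [map_zero]
        | tmul x y => simp only [TensorProduct.map_tmul, limAct_of _ g h1]
        | add x y hx hy => simp only [map_add, hx, hy] }

/-- A pure tensor in the value of a tensor product. -/
def valTmul {F F' : FlagFunctor n} {U : FlagCat n} (x : (F.obj U).obj) (y : (F'.obj U).obj) :
    ((F ⊗ F').obj U).obj :=
  TensorProduct.tmul ℂ x y

theorem limDeltaLin_tmul (F F' : FlagFunctor n) (j : ℕ) (x : stdVal F (cst n j))
    (y : stdVal F' (cst n j)) :
    limDeltaLin F F' (limOf (F ⊗ F') j (valTmul x y)) =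
      TensorProduct.tmul ℂ (limOf F j x) (limOf F' j y) :=
  (limDeltaLin_of F F' j _).trans (TensorProduct.map_tmul _ _ _ _)

theorem rep_isIso_of_bijective {X Y : Rep.{0} ℂ (G n)} (f : X ⟶ Y)
    (h : Function.Bijective f.hom) : IsIso f :=
  have := (Rep.mono_iff_injective f).2 h.1
  have := (Rep.epi_iff_surjective f).2 h.2
  isIso_of_mono_of_epi f

instance (F F' : FlagFunctor n) : IsIso (limDelta F F') :=
  rep_isIso_of_bijective _ (limDeltaLin_bijective F F')

/-- The comparison map from the limit of the unit functor to `ℂ`. -/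
def limEtaLin (n : ℕ) : LimSpace (𝟙_ (FlagFunctor n)) →ₗ[ℂ] ℂ :=
  Module.DirectLimit.lift ℂ ℕ _ _ (fun _ => (LinearMap.id : ℂ →ₗ[ℂ] ℂ)) fun _ _ _ _ => rfl

theorem limEtaLin_of (j : ℕ) (x : ℂ) : limEtaLin n (limOf (𝟙_ (FlagFunctor n)) j x) = x :=
  Module.DirectLimit.lift_of _ _ _

theorem limEtaLin_bijective : Function.Bijective (limEtaLin n) := by
  constructor
  · rw [injective_iff_map_eq_zero]
    intro z hz
    obtain ⟨j, x, rfl⟩ := exists_limOf _ z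
    have h : x = (0 : ℂ) := (limEtaLin_of j x).symm.trans hz
    subst h
    exact map_zero _
  · exact fun x => ⟨limOf _ 0 x, limEtaLin_of 0 x⟩

/-- The comparison morphism from the limit of the unit functor to the unit. -/
def limEta (n : ℕ) : (limFunctor n).obj (𝟙_ (FlagFunctor n)) ⟶ 𝟙_ (Rep.{0} ℂ (G n)) :=
  Rep.ofHom
    { toLinearMap := limEtaLin n
      isIntertwining' := fun g => by
        refine LinearMap.ext fun z => ?_
        obtain ⟨j, x, rfl⟩ := exists_limOf _ z
        obtain ⟨l, hl⟩ := exists_level g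
        have h1 := hl.maps (le_max_left j l) (le_max_right j l)
        change limEtaLin n (limAct _ g (limOf _ j x)) = limEtaLin n (limOf _ j x)
        rw [limAct_of _ g h1]
        exact (limEtaLin_of _ _).trans (limEtaLin_of j x).symm }

theorem limEta_of (j : ℕ) (x : ℂ) :
    (limEta n).hom (limOf (𝟙_ (FlagFunctor n)) j x) = x := limEtaLin_of j x

instance : IsIso (limEta n) := rep_isIso_of_bijective _ limEtaLin_bijective

theorem lim_hom_ext_tensor {F F' : FlagFunctor n} {X : Rep.{0} ℂ (G n)}
    {f g : (limFunctor n).obj (F ⊗ F') ⟶ X}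
    (h : ∀ j (x : stdVal F (cst n j)) (y : stdVal F' (cst n j)),
      f.hom (limOf (F ⊗ F') j (valTmul x y)) = g.hom (limOf (F ⊗ F') j (valTmul x y))) : f = g := by
  refine lim_hom_ext fun j x => ?_
  have : f.hom.toLinearMap ∘ₗ limOf (F ⊗ F') j = g.hom.toLinearMap ∘ₗ limOf (F ⊗ F') j :=
    TensorProduct.ext' fun x y => h j x y
  exact LinearMap.congr_fun this x

theorem lim_hom_ext_tensor₃ {F F' F'' : FlagFunctor n} {X : Rep.{0} ℂ (G n)}
    {f g : (limFunctor n).obj ((F ⊗ F') ⊗ F'') ⟶ X}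
    (h : ∀ j (x : stdVal F (cst n j)) (y : stdVal F' (cst n j)) (z : stdVal F'' (cst n j)),
      f.hom (limOf ((F ⊗ F') ⊗ F'') j (valTmul (F := F ⊗ F') (valTmul x y) z)) =
        g.hom (limOf ((F ⊗ F') ⊗ F'') j (valTmul (F := F ⊗ F') (valTmul x y) z))) :
    f = g := by
  refine lim_hom_ext fun j x => ?_
  have : f.hom.toLinearMap ∘ₗ limOf ((F ⊗ F') ⊗ F'') j =
      g.hom.toLinearMap ∘ₗ limOf ((F ⊗ F') ⊗ F'') j :=
    TensorProduct.ext_threefold fun x y z => h j x y z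
  exact LinearMap.congr_fun this x

/-- The oplax direction is the convenient one, since maps out of a direct limit are given level by
level. Each coherence law is checked on pure tensors of one level; the monoidal structure is then
obtained by inverting `η` and `δ`. -/
instance : (limFunctor n).OplaxMonoidal where
  η := limEta n
  δ := limDelta
  δ_natural_left {F F'} f X := lim_hom_ext_tensor fun j x y => by
    change TensorProduct.map (limMap f) (LinearMap.id : LimSpace X →ₗ[ℂ] LimSpace X)
        (limDeltaLin F X (limOf (F ⊗ X) j (valTmul x y))) =
      limDeltaLin F' X (limMap (f ▷ X) (limOf (F ⊗ X) j (valTmul x y)))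
    rw [limDeltaLin_tmul, limMap_of, TensorProduct.map_tmul, limMap_of]
    exact (limDeltaLin_tmul F' X j _ _).symm
  δ_natural_right {F F'} X f := lim_hom_ext_tensor fun j x y => by
    change TensorProduct.map (LinearMap.id : LimSpace X →ₗ[ℂ] LimSpace X) (limMap f)
        (limDeltaLin X F (limOf (X ⊗ F) j (valTmul x y))) =
      limDeltaLin X F' (limMap (X ◁ f) (limOf (X ⊗ F) j (valTmul x y)))
    rw [limDeltaLin_tmul, limMap_of, TensorProduct.map_tmul, limMap_of]
    exact (limDeltaLin_tmul X F' j _ _).symm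
  oplax_associativity X Y Z := lim_hom_ext_tensor₃ fun j x y z => by
    change TensorProduct.assoc ℂ (LimSpace X) (LimSpace Y) (LimSpace Z)
        (TensorProduct.map (limDeltaLin X Y) (LinearMap.id : LimSpace Z →ₗ[ℂ] LimSpace Z)
          (limDeltaLin (X ⊗ Y) Z (limOf ((X ⊗ Y) ⊗ Z) j (valTmul (F := X ⊗ Y) (valTmul x y) z)))) =
      TensorProduct.map (LinearMap.id : LimSpace X →ₗ[ℂ] LimSpace X) (limDeltaLin Y Z)
        (limDeltaLin X (Y ⊗ Z) (limMap (α_ X Y Z).hom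
          (limOf ((X ⊗ Y) ⊗ Z) j (valTmul (F := X ⊗ Y) (valTmul x y) z))))
    rw [limDeltaLin_tmul, limMap_of, TensorProduct.map_tmul, limDeltaLin_tmul]
    refine Eq.trans ?_ (congrArg _
      (limDeltaLin_tmul X (Y ⊗ Z) j x (valTmul (F := Y) (F' := Z) y z)).symm)
    rw [TensorProduct.map_tmul, limDeltaLin_tmul]
    rfl
  oplax_left_unitality X := lim_hom_ext fun j x => by
    change (TensorProduct.lid ℂ (LimSpace X)).symm (limOf X j x) =
      TensorProduct.map (limEtaLin n) (LinearMap.id : LimSpace X →ₗ[ℂ] LimSpace X)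
        (limDeltaLin (𝟙_ _) X (limMap (λ_ X).inv (limOf X j x)))
    rw [limMap_of]
    refine Eq.trans ?_ (congrArg _ (limDeltaLin_tmul (𝟙_ _) X j (1 : ℂ) x).symm)
    rw [TensorProduct.map_tmul, limEtaLin_of]
    rfl
  oplax_right_unitality X := lim_hom_ext fun j x => by
    change (TensorProduct.rid ℂ (LimSpace X)).symm (limOf X j x) =
      TensorProduct.map (LinearMap.id : LimSpace X →ₗ[ℂ] LimSpace X) (limEtaLin n)
        (limDeltaLin X (𝟙_ _) (limMap (ρ_ X).inv (limOf X j x)))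
    rw [limMap_of]
    refine Eq.trans ?_ (congrArg _ (limDeltaLin_tmul X (𝟙_ _) j x (1 : ℂ)).symm)
    rw [TensorProduct.map_tmul, limEtaLin_of]
    rfl

instance : IsIso (Functor.OplaxMonoidal.η (limFunctor n)) := inferInstanceAs (IsIso (limEta n))

instance (F F' : FlagFunctor n) : IsIso (Functor.OplaxMonoidal.δ (limFunctor n) F F') :=
  inferInstanceAs (IsIso (limDelta F F'))

instance : (limFunctor n).Monoidal := Functor.Monoidal.ofOplaxMonoidal _

theorem lim_braided (F F' : FlagFunctor n) : limDelta F F' ≫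
    (β_ ((limFunctor n).obj F) ((limFunctor n).obj F')).hom =
      (limFunctor n).map (β_ F F').hom ≫ limDelta F' F := lim_hom_ext_tensor fun j x y => by
  change TensorProduct.comm ℂ (LimSpace F) (LimSpace F')
      (limDeltaLin F F' (limOf (F ⊗ F') j (valTmul x y))) =
    limDeltaLin F' F (limMap (β_ F F').hom (limOf (F ⊗ F') j (valTmul x y)))
  rw [limDeltaLin_tmul, limMap_of]
  exact (limDeltaLin_tmul F' F j y x).symm

theorem lim_delta_mu (F F' : FlagFunctor n) :
    limDelta F F' ≫ Functor.LaxMonoidal.μ (limFunctor n) F F' = 𝟙 _ :=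
  Functor.Monoidal.δ_μ (limFunctor n) F F'

instance : (limFunctor n).Braided where
  braided F F' := by
    rw [← cancel_epi (limDelta F F'), reassoc_of% lim_delta_mu, reassoc_of% lim_braided,
      lim_delta_mu, Category.comp_id]

/-- Because `μ` is the inverse of `limDelta`, it is the canonical structure induced by `(x, y) ↦ x ⊗
y`. -/
theorem lim_mu_tmul (F F' : FlagFunctor n) (j : ℕ) (x : stdVal F (cst n j))
    (y : stdVal F' (cst n j)) :
    (Functor.LaxMonoidal.μ (limFunctor n) F F').hom
      (TensorProduct.tmul ℂ (limOf F j x) (limOf F' j y)) =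
      limOf (F ⊗ F') j (valTmul x y) :=
  (congrArg (Functor.LaxMonoidal.μ (limFunctor n) F F').hom
    (limDeltaLin_tmul F F' j x y).symm).trans
    (congrArg (fun f => f.hom (limOf (F ⊗ F') j (valTmul x y))) (lim_delta_mu F F'))

theorem lim_epsilon (j : ℕ) : (Functor.LaxMonoidal.ε (limFunctor n)).hom (1 : ℂ) =
    limOf (𝟙_ (FlagFunctor n)) j (1 : ℂ) := by
  have h := congrArg (fun f => f.hom (limOf (𝟙_ (FlagFunctor n)) j (1 : ℂ)))
    (Functor.Monoidal.η_ε (limFunctor n))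
  refine Eq.trans ?_ h
  exact congrArg _ (limEta_of j 1).symm

end Tensor

/-! ### The direct limit of a polynomial functor is polynomial -/

section Forget

variable {n : ℕ}

/-- The comparison map from the limit of the spaces `ℂ^{(jⁿ)}` to the standard representation. -/
def limForgetLin (n : ℕ) : LimSpace (flagForget n) →ₗ[ℂ] VInf n :=
  Module.DirectLimit.lift ℂ ℕ _ _ (fun j => (stdSub (cst n j)).subtype) fun _ _ _ _ => rfl

theorem limForgetLin_of (j : ℕ) (x : stdSub (cst n j)) :
    limForgetLin n (limOf (flagForget n) j x) = x :=
  Module.DirectLimit.lift_of _ _ _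

theorem limForgetLin_bijective : Function.Bijective (limForgetLin n) := by
  constructor
  · rw [injective_iff_map_eq_zero]
    intro z hz
    obtain ⟨j, x, rfl⟩ := exists_limOf _ z
    change stdSub (cst n j) at x
    have h : x = 0 := Subtype.ext ((limForgetLin_of j x).symm.trans hz)
    subst h
    exact map_zero _
  · intro x
    obtain ⟨j, hj⟩ := exists_mem_stdSub x
    exact ⟨limOf (flagForget n) j (⟨x, hj⟩ : stdSub (cst n j)), limForgetLin_of j _⟩

/-- The comparison morphism from the limit of the forgetful functor to the standard
representation. -/
def limForget (n : ℕ) : (limFunctor n).obj (flagForget n) ⟶ stdRep n :=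
  Rep.ofHom
    { toLinearMap := limForgetLin n
      isIntertwining' := fun g => by
        refine LinearMap.ext fun z => ?_
        obtain ⟨j, x, rfl⟩ := exists_limOf _ z
        obtain ⟨l, hl⟩ := exists_level g
        have h1 := hl.maps (le_max_left j l) (le_max_right j l)
        change limForgetLin n (limAct _ g (limOf _ j x)) =
          toEnd g (limForgetLin n (limOf _ j x))
        rw [limAct_of _ g h1]
        exact (limForgetLin_of _ _).trans (congrArg (toEnd g) (limForgetLin_of j x).symm) }

instance : IsIso (limForget n) := rep_isIso_of_bijective _ limForgetLin_bijective

/-- The direct limit functor commutes with tensor powers. -/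
def limTensorPow (T : FlagFunctor n) :
    (k : ℕ) → ((limFunctor n).obj (tensorPow T k) ≅ tensorPow ((limFunctor n).obj T) k)
  | 0 => (Functor.Monoidal.εIso (limFunctor n)).symm
  | k + 1 => (Functor.Monoidal.μIso (limFunctor n) (tensorPow T k) T).symm ≪≫
      whiskerRightIso (limTensorPow T k) _

/-- Isomorphic objects have isomorphic tensor powers. -/
def tensorPowIso {C : Type*} [Category C] [MonoidalCategory C] {S T : C} (e : S ≅ T) :
    (k : ℕ) → (tensorPow S k ≅ tensorPow T k)
  | 0 => Iso.refl _
  | k + 1 => tensorIso (tensorPowIso e k) e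

/-- The direct limit functor commutes with finite direct sums of tensor powers. -/
def limSum {k : ℕ} (a : Fin k → ℕ) :
    (limFunctor n).obj (⨁ fun i => tensorPow (flagForget n) (a i)) ≅
      ⨁ fun i => tensorPow (stdRep n) (a i) :=
  have := (limFunctor n).preservesFiniteBiproductsOfAdditive
  (limFunctor n).mapBiproduct _ ≪≫ Limits.biproduct.mapIso fun i =>
    limTensorPow (flagForget n) (a i) ≪≫ tensorPowIso (asIso (limForget n)) (a i)

/-- The direct limit preserves monomorphisms, epimorphisms, finite direct sums and tensor powers, so
it carries a presentation of `F` to a presentation by tensor powers of the standard representation.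
-/
theorem isPolyRep_lim (F : PolyFunctor n) : isPolyRep n ((limFunctor n).obj F.obj) := by
  obtain ⟨k, a, Z, i, q, hi, hq⟩ := F.property
  have := limFunctor_map_mono i
  exact ⟨k, a, (limFunctor n).obj Z, (limFunctor n).map i ≫ (limSum a).hom, (limFunctor n).map q,
    inferInstance, limFunctor_map_epi q⟩

end Forget

/-! ### The action of the endomorphisms on the direct limit -/

section LimEnd

variable {n : ℕ} (F : FlagFunctor n)

/-- The action of a flag preserving endomorphism of a finite level on the direct limit. -/
def limEndAct (A : flagEnd n) : LimSpace F →ₗ[ℂ] LimSpace F :=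
  Module.DirectLimit.lift ℂ ℕ _ _
    (fun j => limOf F (max j A.2.2.choose) ∘ₗ
      mapLin F (stdHom (A : Module.End ℂ (VInf n)) A.2.1
        (A.2.2.choose_spec.maps (le_max_left _ _) (le_max_right _ _))))
    (by
      intro i j hij x
      simp only [LinearMap.comp_apply]
      rw [mapLin_comp]
      rw [← limOf_incl' F (j := max i A.2.2.choose) (k := max j A.2.2.choose)
        (max_le_max_right _ hij), mapLin_comp]
      rfl)

theorem limEndAct_of (A : flagEnd n) {j k : ℕ}
    (h : ∀ x ∈ stdSub (cst n j), (A : Module.End ℂ (VInf n)) x ∈ stdSub (cst n k))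
    (x : stdVal F (cst n j)) :
    limEndAct F A (limOf F j x) =
      limOf F k (mapLin F (stdHom (A : Module.End ℂ (VInf n)) A.2.1 h) x) := by
  rw [limEndAct, limOf, Module.DirectLimit.lift_of]
  simp only [LinearMap.comp_apply]
  set m := max j A.2.2.choose
  rw [← limOf_incl' F (j := m) (k := max m k) (le_max_left _ _),
    ← limOf_incl' F (j := k) (k := max m k) (le_max_right _ _), mapLin_comp, mapLin_comp]
  rfl

/-- The action of the monoid of endomorphisms on the direct limit. -/
def limEnd : flagEnd n →* Module.End ℂ (LimSpace F) where
  toFun := limEndAct F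
  map_one' := by
    refine LinearMap.ext fun z => ?_
    obtain ⟨j, x, rfl⟩ := exists_limOf F z
    rw [limEndAct_of F 1 (k := j) (fun x hx => hx)]
    exact congrArg _ (mapLin_id F _ x)
  map_mul' B A := by
    refine LinearMap.ext fun z => ?_
    obtain ⟨j, x, rfl⟩ := exists_limOf F z
    obtain ⟨-, l, hl⟩ := A.2
    obtain ⟨-, m, hm⟩ := B.2
    have h1 := hl.maps (le_max_left j l) (le_max_right j l)
    have h2 := hm.maps (le_max_left (max j l) m) (le_max_right (max j l) m)
    rw [Module.End.mul_apply, limEndAct_of F A h1, limEndAct_of F B h2, mapLin_comp,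
      limEndAct_of F (B * A) (k := max (max j l) m) (fun x hx => h2 _ (h1 x hx))]
    rfl

theorem limEnd_of (A : flagEnd n) {j k : ℕ}
    (h : ∀ x ∈ stdSub (cst n j), (A : Module.End ℂ (VInf n)) x ∈ stdSub (cst n k))
    (x : stdVal F (cst n j)) :
    limEnd F A (limOf F j x) =
      limOf F k (mapLin F (stdHom (A : Module.End ℂ (VInf n)) A.2.1 h) x) :=
  limEndAct_of F A h x

theorem limEnd_toEnd (g : G n) (A : flagEnd n) (hA : (A : Module.End ℂ (VInf n)) = toEnd g)
    (z : LimSpace F) : limEnd F A z = limAct F g z := by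
  obtain ⟨j, x, rfl⟩ := exists_limOf F z
  obtain ⟨l, hl⟩ := exists_level g
  have h1 := hl.maps (le_max_left j l) (le_max_right j l)
  rw [limAct_of F g h1]
  obtain ⟨A, hA'⟩ := A
  obtain rfl : A = toEnd g := hA
  exact limEnd_of F ⟨toEnd g, hA'⟩ h1 x

theorem limEnd_natural {F F' : FlagFunctor n} (η : F ⟶ F') (A : flagEnd n) (z : LimSpace F) :
    limMap η (limEnd F A z) = limEnd F' A (limMap η z) := by
  obtain ⟨j, x, rfl⟩ := exists_limOf F z
  obtain ⟨-, l, hl⟩ := A.2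
  have h1 := hl.maps (le_max_left j l) (le_max_right j l)
  rw [limEnd_of F A h1, limMap_of, limMap_of, limEnd_of F' A h1, mapLin_natural]

/-- On each finite level the action of the endomorphisms on the direct limit is polynomial. -/
def HasPolyEnd : Prop :=
  ∀ (j : ℕ) (x : LimSpace F), ∃ p : Module.End ℂ (VInf n) → LimSpace F, IsPolyMap p ∧
    ∀ A : flagEnd n, IsLevel j (A : Module.End ℂ (VInf n)) → limEnd F A x = p A

namespace HasPolyEnd

variable {F} {F' : FlagFunctor n}

/-- A merely linear retraction of the injection of limits suffices, as polynomial maps are stable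
under composition with linear maps. -/
theorem of_mono (f : F ⟶ F') [Mono f] (h : HasPolyEnd F') : HasPolyEnd F := by
  intro j x
  obtain ⟨p, hp, hpA⟩ := h j (limMap f x)
  obtain ⟨r, hr⟩ := LinearMap.exists_leftInverse_of_injective (limMap f)
    (LinearMap.ker_eq_bot.2 ((Rep.mono_iff_injective _).1 (limFunctor_map_mono f)))
  refine ⟨fun A => r (p A), hp.map r, fun A hA => ?_⟩
  simp only
  rw [← hpA A hA, ← limEnd_natural]
  exact (LinearMap.congr_fun hr _).symm

theorem of_epi (f : F ⟶ F') [Epi f] (h : HasPolyEnd F) : HasPolyEnd F' := by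
  intro j y
  obtain ⟨x, rfl⟩ : ∃ x, limMap f x = y := (Rep.epi_iff_surjective _).1 (limFunctor_map_epi f) y
  obtain ⟨p, hp, hpA⟩ := h j x
  refine ⟨fun A => limMap f (p A), hp.map (limMap f), fun A hA => ?_⟩
  simp only
  rw [← hpA A hA, limEnd_natural]

theorem unit : HasPolyEnd (𝟙_ (FlagFunctor n)) := by
  intro j z
  refine ⟨fun _ => z, IsPolyMap.const z, fun A _ => ?_⟩
  obtain ⟨k, x, rfl⟩ := exists_limOf _ z
  obtain ⟨-, l, hl⟩ := A.2
  rw [limEnd_of _ A (hl.maps (le_max_left k l) (le_max_right k l))]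
  -- The unit functor sends every morphism to the identity of `ℂ`, so the morphism induced by `A`
  -- may be replaced by the inclusion.
  exact limOf_incl' (𝟙_ (FlagFunctor n)) (le_max_left k l) x

theorem limDeltaLin_limEnd (A : flagEnd n) (z : LimSpace (F ⊗ F')) :
    limDeltaLin F F' (limEnd (F ⊗ F') A z) =
      TensorProduct.map (limEnd F A) (limEnd F' A) (limDeltaLin F F' z) := by
  obtain ⟨j, x, rfl⟩ := exists_limOf _ z
  obtain ⟨-, l, hl⟩ := A.2
  have h1 := hl.maps (le_max_left j l) (le_max_right j l)
  rw [limEnd_of _ A h1]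
  refine (limDeltaLin_of _ _ _ _).trans (Eq.trans ?_
    (congrArg (TensorProduct.map (limEnd F A) (limEnd F' A)) (limDeltaLin_of F F' j x).symm))
  change TensorProduct ℂ (stdVal F (cst n j)) (stdVal F' (cst n j)) at x
  change TensorProduct.map _ _ (TensorProduct.map (mapLin F _) (mapLin F' _) x) = _
  induction x using TensorProduct.induction_on with
  | zero => simp only [map_zero]
  | tmul x y => simp only [TensorProduct.map_tmul, limEnd_of _ A h1]
  | add x y hx hy => simp only [map_add, hx, hy]

theorem tensor (h : HasPolyEnd F) (h' : HasPolyEnd F') : HasPolyEnd (F ⊗ F') := by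
  intro j z
  let e := LinearEquiv.ofBijective _ (limDeltaLin_bijective F F')
  have key : ∀ t : TensorProduct ℂ (LimSpace F) (LimSpace F'),
      ∃ p : Module.End ℂ (VInf n) → TensorProduct ℂ (LimSpace F) (LimSpace F'), IsPolyMap p ∧
        ∀ A : flagEnd n, IsLevel j (A : Module.End ℂ (VInf n)) →
          TensorProduct.map (limEnd F A) (limEnd F' A) t = p A := by
    intro t
    induction t using TensorProduct.induction_on with
    | zero => exact ⟨fun _ => 0, IsPolyMap.const _, fun A _ => map_zero _⟩
    | tmul x y =>
      obtain ⟨p, hp, hpA⟩ := h j x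
      obtain ⟨q, hq, hqA⟩ := h' j y
      exact ⟨_, hp.tmul hq, fun A hA => by rw [TensorProduct.map_tmul, hpA A hA, hqA A hA]⟩
    | add x y hx hy =>
      obtain ⟨p, hp, hpA⟩ := hx
      obtain ⟨q, hq, hqA⟩ := hy
      exact ⟨_, hp.add hq, fun A hA => by rw [map_add, hpA A hA, hqA A hA]; rfl⟩
  obtain ⟨p, hp, hpA⟩ := key (e z)
  refine ⟨fun A => e.symm (p A), hp.map e.symm.toLinearMap, fun A hA => ?_⟩
  simp only
  rw [← hpA A hA, LinearEquiv.eq_symm_apply]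
  exact limDeltaLin_limEnd A z

theorem forget : HasPolyEnd (flagForget n) := by
  classical
  intro j z
  let e := LinearEquiv.ofBijective _ (limForgetLin_bijective (n := n))
  -- An endomorphism of level `j` changes only the part of a vector in `ℂ^{(jⁿ)}`, so the image of
  -- `e z` is supported in this fixed finite set, and its coordinates are linear in `A`.
  let S : Finset (Fin n × ℕ) := (finite_stdSub_index (cst n j)).toFinset ∪ (e z).support
  have hz : ∀ A : flagEnd n, e (limEnd _ A z) = (A : Module.End ℂ (VInf n)) (e z) := by
    intro A
    obtain ⟨k, x, rfl⟩ := exists_limOf _ z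
    obtain ⟨-, l, hl⟩ := A.2
    rw [limEnd_of _ A (hl.maps (le_max_left k l) (le_max_right k l))]
    exact (limForgetLin_of _ _).trans (congrArg _ (limForgetLin_of k x).symm)
  obtain ⟨p, hp, hpg⟩ : ∃ p : Module.End ℂ (VInf n) → VInf n, IsPolyMap p ∧
      ∀ A : flagEnd n, IsLevel j (A : Module.End ℂ (VInf n)) →
        p A = (A : Module.End ℂ (VInf n)) (e z) := by
    refine ⟨∑ s ∈ S, fun A => (A (e z) s) • (Finsupp.single s 1 : VInf n),
      IsPolyMap.sum S fun s _ =>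
        IsPolyMap.linear ((Finsupp.lapply s) ∘ₗ (LinearMap.applyₗ (e z))) _, fun A hA => ?_⟩
    have hmem : (A : Module.End ℂ (VInf n)) (e z) ∈
        Finsupp.supported ℂ ℂ (S : Set (Fin n × ℕ)) := by
      obtain ⟨y, w, hx, hy, hw, -⟩ := split_level j (e z)
      have h1 : stdSub (cst n j) ≤ Finsupp.supported ℂ ℂ (S : Set (Fin n × ℕ)) :=
        Finsupp.supported_mono fun p hp => by
          simp only [S, Finset.coe_union, Set.Finite.coe_toFinset]; exact Or.inl hp
      have h2 : e z ∈ Finsupp.supported ℂ ℂ (S : Set (Fin n × ℕ)) := by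
        rw [Finsupp.mem_supported]; simp [S]
      have h3 : (A : Module.End ℂ (VInf n)) (e z) =
          (A : Module.End ℂ (VInf n)) y + (e z - y) := by
        rw [hx, map_add, hA.fix hw]; abel
      rw [h3]
      exact add_mem (h1 (hA.1 y hy)) (sub_mem h2 (h1 hy))
    rw [Finsupp.mem_supported] at hmem
    conv_rhs => rw [← Finsupp.sum_single ((A : Module.End ℂ (VInf n)) (e z))]
    rw [Finsupp.sum_of_support_subset _ (Finset.coe_subset.1 hmem) _ (by simp), Finset.sum_apply]
    exact Finset.sum_congr rfl fun s _ => by simp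
  refine ⟨fun A => e.symm (p A), hp.map e.symm.toLinearMap, fun A hA => ?_⟩
  simp only
  rw [hpg A hA, LinearEquiv.eq_symm_apply, hz]

theorem tensorPow (h : HasPolyEnd F) : ∀ k, HasPolyEnd (tensorPow F k)
  | 0 => unit
  | k + 1 => (tensorPow h k).tensor h

open Limits in
theorem biproduct {k : ℕ} (X : Fin k → FlagFunctor n) (h : ∀ i, HasPolyEnd (X i)) :
    HasPolyEnd (⨁ X) := by
  intro j x
  choose p hp hpA using fun i => h i j (limMap (biproduct.π X i) x)
  refine ⟨∑ i, fun A => limMap (biproduct.ι X i) (p i A),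
    IsPolyMap.sum _ fun i _ => (hp i).map (limMap (biproduct.ι X i)), fun A hA => ?_⟩
  -- The limit functor is additive, so the decomposition of the identity as the sum of `π ≫ ι`
  -- persists on the limit.
  have htot : ∀ y : LimSpace (⨁ X),
      y = ∑ i, limMap (biproduct.ι X i) (limMap (biproduct.π X i) y) := by
    intro y
    have h1 := congrArg (fun f => ((limFunctor n).map f).hom.toLinearMap)
      (biproduct.total (f := X))
    simp only [Functor.map_sum, Functor.map_comp, Rep.sum_hom,
      Representation.IntertwiningMap.toLinearMap_sum] at h1
    have h2 : ((limFunctor n).map (𝟙 (⨁ X))).hom.toLinearMap = LinearMap.id :=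
      congrArg (fun f => f.hom.toLinearMap) ((limFunctor n).map_id (⨁ X))
    exact (LinearMap.congr_fun (h2.symm.trans h1.symm) y).trans (LinearMap.sum_apply _ _ _)
  rw [Finset.sum_apply]
  refine (htot _).trans (Finset.sum_congr rfl fun i _ => ?_)
  rw [limEnd_natural, hpA i A hA]

theorem of_isPolyFunctor (h : isPolyFunctor n F) : HasPolyEnd F := by
  obtain ⟨k, a, Z, i, q, hi, hq⟩ := h
  have h1 : HasPolyEnd Z := of_mono i (biproduct _ fun i => tensorPow forget (a i))
  exact of_epi q h1

end HasPolyEnd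

/-- The direct limit of a polynomial functor, as a polynomial representation. -/
abbrev limPoly (F : PolyFunctor n) : PolyRep n := ⟨(limFunctor n).obj F.obj, isPolyRep_lim F⟩

/-- Both sides are polynomial extensions of the same `𝐆`-action, and such an extension is unique by
density of the invertible endomorphisms. This translates the intrinsic action on a representation
into the functoriality of `F`. -/
theorem endAction_lim (F : PolyFunctor n) : endAction (limPoly F) = limEnd F.obj :=
  endAction_unique (endAction_spec (limPoly F))
    { extends_action := fun g A hA => LinearMap.ext fun z => limEnd_toEnd F.obj g A hA z
      polynomial := HasPolyEnd.of_isPolyFunctor F.property }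

end LimEnd

/-! ### Every flag is a retract of a standard flag -/

section Retract

theorem exists_projection {U : Type} [AddCommGroup U] [Module ℂ U] (W : Submodule ℂ U) :
    ∃ e : U →ₗ[ℂ] U, (∀ x, e x ∈ W) ∧ ∀ x ∈ W, e x = x := by
  obtain ⟨p, hp⟩ := LinearMap.exists_leftInverse_of_injective W.subtype W.ker_subtype
  exact ⟨W.subtype ∘ₗ p, fun x => (p x).2, fun x hx =>
    congrArg Subtype.val (LinearMap.congr_fun hp ⟨x, hx⟩)⟩

/-- A filtered vector space is the direct sum of complements of the successive steps. -/
theorem exists_splitting {U : Type} [AddCommGroup U] [Module ℂ U] {f : ℕ → Submodule ℂ U}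
    (hf : Monotone f) (h0 : f 0 = ⊥) (m : ℕ) :
    ∃ c : ℕ → U →ₗ[ℂ] U, (∀ i x, c i x ∈ f (i + 1)) ∧ (∀ i, ∀ x ∈ f i, c i x = 0) ∧
      ∀ x ∈ f m, ∑ i ∈ Finset.range m, c i x = x := by
  classical
  induction m with
  | zero =>
    refine ⟨0, fun _ _ => zero_mem _, fun _ _ _ => rfl, fun x hx => ?_⟩
    rw [h0, Submodule.mem_bot] at hx
    simp [hx]
  | succ m ih =>
    obtain ⟨c, hc, hc0, hcs⟩ := ih
    obtain ⟨e, he, he'⟩ := exists_projection (f m)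
    obtain ⟨e₁, he₁, he₁'⟩ := exists_projection (f (m + 1))
    -- For `x` in `f (m + 1)` the old components decompose `e x`, and the new one is `x - e x`. The
    -- factor `e₁` only serves to keep the new component in `f (m + 1)` for arbitrary `x`.
    refine ⟨Function.update (fun i => c i ∘ₗ e) m (e₁ ∘ₗ (LinearMap.id - e)),
      fun i x => ?_, fun i x hx => ?_, fun x hx => ?_⟩
    · rcases eq_or_ne i m with rfl | h
      · rw [Function.update_self]; exact he₁ _
      · rw [Function.update_of_ne h]; exact hc _ _
    · rcases eq_or_ne i m with rfl | h
      · rw [Function.update_self]; simp [he' x hx]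
      · rw [Function.update_of_ne h]
        refine hc0 i _ ?_
        -- Below `m` the projection `e` fixes `x`; above `m` its image already lies in `f i`. In
        -- both cases `e x` lies in `f i`.
        rcases le_total i m with h | h
        · rw [he' x (hf h hx)]; exact hx
        · exact hf h (he x)
    · rw [Finset.sum_range_succ, Function.update_self,
        Finset.sum_congr rfl (fun i hi => by
          rw [Function.update_of_ne (Finset.mem_range.1 hi).ne, LinearMap.comp_apply]),
        hcs _ (he x), LinearMap.comp_apply, LinearMap.sub_apply,
        LinearMap.id_apply, he₁' _ (sub_mem hx (hf m.le_succ (he x)))]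
      simp

/-- Split `x` into components `c i x` in the successive steps, and record the coordinates of each,
in one fixed basis of `U`, in the `i`-th copy of `ℂ^d`. The way back sends the `k`-th basis vector
of that copy to the projection of `b k` to step `i + 1`. The composite is the sum of the projected
components, that is, of the `c i x`. Neither an adapted basis nor the dimensions of the graded
pieces are needed, since only a retract is required. -/
theorem exists_retract {n : ℕ} (U : FlagCat n) :
    ∃ (d : ℕ) (s : U ⟶ stdFlag (cst n d)) (r : stdFlag (cst n d) ⟶ U), s ≫ r = 𝟙 U := by
  -- The filtration is continued as constant beyond `n`, to be indexed by all natural numbers.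
  let f : ℕ → Submodule ℂ U.carrier := fun k => U.fil ⟨min k n, by omega⟩
  have hf : Monotone f := fun i j hij => U.mono (by rw [Fin.mk_le_mk]; omega)
  have hfil : ∀ i : Fin (n + 1), f i = U.fil i := fun i =>
    congrArg U.fil (Fin.ext (by have := i.2; simp only; omega))
  have h0 : f 0 = ⊥ := (hfil 0).trans U.fil_zero
  have hn : f n = ⊤ := (hfil (Fin.last n)).trans U.fil_last
  obtain ⟨c, hc, hc0, hcs⟩ := exists_splitting hf h0 n
  choose e he he' using fun i => exists_projection (f i)
  let d := Module.finrank ℂ U.carrier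
  let b : Module.Basis (Fin d) ℂ U.carrier := Module.finBasis ℂ U.carrier
  let s₀ : U.carrier →ₗ[ℂ] VInf n := ∑ i : Fin n, ∑ k : Fin d,
    (LinearMap.toSpanSingleton ℂ (VInf n) (Finsupp.single (i, (k : ℕ)) 1)) ∘ₗ b.coord k ∘ₗ c i
  have hs₀ : ∀ x, s₀ x = ∑ i : Fin n, ∑ k : Fin d,
      b.repr (c i x) k • (Finsupp.single (i, (k : ℕ)) 1 : VInf n) := fun x => by
    simp [s₀, LinearMap.sum_apply]
  let r₀ : VInf n →ₗ[ℂ] U.carrier := Finsupp.linearCombination ℂ fun p : Fin n × ℕ =>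
    -- Graded pieces are numbered from `0`, so piece `p.1` belongs to step `p.1 + 1`. The default
    -- `0` concerns basis vectors outside `ℂ^{(dⁿ)}`.
    if h : p.2 < d then e (p.1 + 1) (b ⟨p.2, h⟩) else 0
  have hmem : ∀ x, s₀ x ∈ stdSub (cst n d) := fun x => by
    rw [hs₀]
    exact Submodule.sum_mem _ fun i _ => Submodule.sum_mem _ fun k _ =>
      Submodule.smul_mem _ _ (single_mem_stdSub (a := cst n d) k.2 1)
  refine ⟨d, FlagCat.Hom.mk (W := stdFlag (cst n d)) (s₀.codRestrict _ hmem) fun i x hx => ?_,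
    FlagCat.Hom.mk (V := stdFlag (cst n d)) (r₀ ∘ₗ (stdSub (cst n d)).subtype) fun i x hx => ?_,
    FlagCat.Hom.ext (LinearMap.ext fun x => ?_)⟩
  · change s₀ x ∈ flagSub n i
    rw [hs₀]
    refine Submodule.sum_mem _ fun k _ => Submodule.sum_mem _ fun l _ => ?_
    by_cases hk : (k : ℕ) < i
    · exact Submodule.smul_mem _ _ (single_mem_flagSub hk 1)
    -- A vector of step `i` has no components of index at least `i`.
    · rw [hc0 k x (hf (not_lt.1 hk) (by rw [hfil]; exact hx))]
      simp
  · change stdSub (cst n d) at x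
    change (x : VInf n) ∈ flagSub n i at hx
    change r₀ x ∈ U.fil i
    revert hx
    suffices h : flagSub n i ≤ (U.fil i).comap r₀ from fun hx => h hx
    rw [flagSub, Finsupp.supported_eq_span_single, Submodule.span_le]
    rintro _ ⟨p, hp, rfl⟩
    change r₀ _ ∈ U.fil i
    rw [Finsupp.linearCombination_single, one_smul, ← hfil]
    split_ifs
    · exact hf (Nat.succ_le_of_lt hp) (he _ _)
    · exact zero_mem _
  · change r₀ (s₀ x) = x
    have hr : ∀ (i : Fin n) (k : Fin d), r₀ (Finsupp.single (i, (k : ℕ)) 1) = e (i + 1) (b k) :=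
      fun i k => by
        rw [Finsupp.linearCombination_single, one_smul, dif_pos k.2]
    rw [hs₀, map_sum]
    simp only [map_sum, map_smul, hr]
    refine Eq.trans ?_ ((Finset.sum_range fun i => c i x).symm.trans (hcs x (by rw [hn]; trivial)))
    refine Finset.sum_congr rfl fun i _ => ?_
    conv_rhs => rw [← he' (i + 1) (c i x) (hc i x), ← b.sum_repr (c i x), map_sum]
    simp only [map_smul]

/-- Embed `U` as a retract of a standard flag: `F'` of the embedding is injective, so naturality
reduces equality at `U` to equality at the standard flag. -/
theorem natTrans_ext_std {n : ℕ} {F F' : FlagFunctor n} {η θ : F ⟶ F'}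
    (h : ∀ j (x : stdVal F (cst n j)), (η.app (stdFlag (cst n j))).hom.hom x =
      (θ.app (stdFlag (cst n j))).hom.hom x) : η = θ := by
  refine NatTrans.ext (funext fun U => ?_)
  obtain ⟨d, s, r, hsr⟩ := exists_retract U
  refine ObjectProperty.hom_ext _ (ModuleCat.hom_ext (LinearMap.ext fun x => ?_))
  refine mapLin_injective_of_retract F' hsr ?_
  rw [← mapLin_natural, ← mapLin_natural]
  exact h d _

end Retract

/-! ### The values of a polynomial functor as spaces of invariants -/

section Values

variable {n : ℕ} (F : FlagFunctor n)

theorem le_cst_sup (a : Fin n → ℕ) : a ≤ cst n (Finset.univ.sup a) :=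
  fun i => Finset.le_sup (f := a) (Finset.mem_univ i)

/-- The canonical map `F(ℂ^a) → lim F(ℂ^{(jⁿ)})`. -/
def toLim (a : Fin n → ℕ) : stdVal F a →ₗ[ℂ] LimSpace F :=
  limOf F (Finset.univ.sup a) ∘ₗ mapLin F (stdIncl (le_cst_sup a))

/-- The level used to define `toLim` is immaterial, so any convenient larger one may be chosen. -/
theorem toLim_eq {a : Fin n → ℕ} {k : ℕ} (h : a ≤ cst n k) (x : stdVal F a) :
    toLim F a x = limOf F k (mapLin F (stdIncl h) x) := by
  set m := max (Finset.univ.sup a) k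
  rw [toLim, LinearMap.comp_apply, ← limOf_incl' F (le_max_left (Finset.univ.sup a) k),
    ← limOf_incl' F (le_max_right (Finset.univ.sup a) k), mapLin_comp, mapLin_comp]
  rfl

theorem toLim_cst (j : ℕ) (x : stdVal F (cst n j)) : toLim F (cst n j) x = limOf F j x :=
  (toLim_eq F le_rfl x).trans (congrArg _ (mapLin_id F _ x))

theorem toLim_injective (a : Fin n → ℕ) : Function.Injective (toLim F a) :=
  (limOf_injective F _).comp (mapLin_injective_of_retract F (stdIncl_trunc (le_cst_sup a)))

variable {F} in
theorem limMap_toLim {F' : FlagFunctor n} (η : F ⟶ F') (a : Fin n → ℕ) (x : stdVal F a) :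
    limMap η (toLim F a x) = toLim F' a ((η.app (stdFlag a)).hom.hom x) := by
  rw [toLim, LinearMap.comp_apply, limMap_of, mapLin_natural]
  rfl

theorem limEnd_toLim (A : flagEnd n) {a b : Fin n → ℕ}
    (h : ∀ x ∈ stdSub a, (A : Module.End ℂ (VInf n)) x ∈ stdSub b) (x : stdVal F a) :
    limEnd F A (toLim F a x) =
      toLim F b (mapLin F (stdHom (A : Module.End ℂ (VInf n)) A.2.1 h) x) := by
  obtain ⟨-, l, hl⟩ := A.2
  have ha : a ≤ cst n (max (lvl a b) l) := (le_lvl_left a b).trans fun _ => le_max_left _ _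
  have hb : b ≤ cst n (max (lvl a b) l) := (le_lvl_right a b).trans fun _ => le_max_left _ _
  rw [toLim_eq F ha, toLim_eq F hb, limEnd_of F A (hl.maps le_rfl (le_max_right (lvl a b) l)),
    mapLin_comp, mapLin_comp]
  rfl

/-- An element of `H_a` restricts to the identity morphism of `ℂ^a`, which every functor preserves.
-/
theorem toLim_mem (a : Fin n → ℕ) (x : stdVal F a) :
    toLim F a x ∈ invariants ((limFunctor n).obj F) a := by
  intro g hg
  let A : flagEnd n := ⟨toEnd g, preservesFlag_toEnd g, exists_level g⟩
  refine (limEnd_toEnd F g A rfl _).symm.trans ?_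
  rw [limEnd_toLim F A (b := a) (fun x hx => by
    change toEnd g x ∈ _
    rw [hg.1 x hx]; exact hx)]
  have : stdHom (toEnd g) (preservesFlag_toEnd g) (fun x hx => by rw [hg.1 x hx]; exact hx) =
      𝟙 (stdFlag a) :=
    stdHom_congr _ PreservesFlag.id _ (fun _ hx => hx) hg.1
  exact congrArg (toLim F a) ((congrArg (fun f => mapLin F f x) this).trans (mapLin_id F _ x))

/-- The canonical map from `F(ℂ^a)` to the invariants of `H_a` on the direct limit. -/
def toInv (a : Fin n → ℕ) : stdVal F a →ₗ[ℂ] invariants ((limFunctor n).obj F) a :=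
  (toLim F a).codRestrict (invariants ((limFunctor n).obj F) a) (toLim_mem F a)

end Values

/-! ### For polynomial functors every invariant is a value -/

section PolyValues

variable {n : ℕ} (F : PolyFunctor n)

theorem toInv_bijective (a : Fin n → ℕ) : Function.Bijective (toInv F.obj a) := by
  refine ⟨fun x y h => toLim_injective F.obj a (congrArg Subtype.val h), fun ⟨z, hz⟩ => ?_⟩
  obtain ⟨k, x, hk, rfl⟩ := exists_limOf_le F.obj z (Finset.univ.sup a)
  -- The diagonal elements of `H_a` with parameter `t ≠ 0` fix `z`, hence so does their degeneration
  -- at `t = 0`. That projection maps `ℂ^{(kⁿ)}` into `ℂ^a`, so `z = P z` comes from `F(ℂ^a)`.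
  let P : flagEnd n := ⟨diagLin a k 0, diagLin_flag a k 0, k, diagLin_level 0⟩
  have h1 := endAction_proj (limPoly F) k hz P rfl
  rw [endAction_lim] at h1
  refine ⟨mapLin F.obj (trunc a k) x, Subtype.ext (Eq.trans ?_ h1)⟩
  refine Eq.trans ?_ ((congrArg (limEnd F.obj P) (toLim_cst F.obj k x)).symm.trans
    (limEnd_toLim F.obj P (b := a) (diagLin_maps a k) x)).symm
  rfl

/-- The value `F(ℂ^a)` is the space of invariants of `H_a` on the direct limit. -/
def invEquiv (a : Fin n → ℕ) :
    stdVal F.obj a ≃ₗ[ℂ] invariants ((limFunctor n).obj F.obj) a :=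
  LinearEquiv.ofBijective _ (toInv_bijective F a)

/-- This makes the identification of values with invariants natural in the standard flag: `F(f)` can
be read off from the representation alone. -/
theorem endAction_extend_toLim {a b : Fin n → ℕ} (f : stdFlag a ⟶ stdFlag b)
    (x : stdVal F.obj a) :
    endAction (limPoly F) (extend f) (toLim F.obj a x) = toLim F.obj b (mapLin F.obj f x) := by
  rw [endAction_lim]
  have h : ∀ x ∈ stdSub a, (extend f : Module.End ℂ (VInf n)) x ∈ stdSub b := fun x hx => by
    change extendLin f x ∈ _
    rw [extendLin_apply f ⟨x, hx⟩]
    exact (stdLin f _).2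
  have h2 : stdHom (extend f : Module.End ℂ (VInf n)) (extend f).2.1 h = f :=
    FlagCat.Hom.ext (LinearMap.ext fun x => Subtype.ext (extendLin_apply f x))
  exact (limEnd_toLim F.obj (extend f) h x).trans
    (congrArg (fun f => toLim F.obj b (mapLin F.obj f x)) h2)

/-- The values of a polynomial functor on the standard flags are the invariants on its direct
limit. -/
def invIso (n : ℕ) : restrictStd n ≅ Phi n isPolyRep_lim ⋙ invFunctor n :=
  NatIso.ofComponents
    (fun F => NatIso.ofComponents (fun a => (invEquiv F a).toModuleIso) fun {a b} f => by
      refine ModuleCat.hom_ext (LinearMap.ext fun x => Subtype.ext ?_)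
      exact (endAction_extend_toLim F f.hom x).symm)
    fun {F F'} η => by
      refine NatTrans.ext (funext fun a => ModuleCat.hom_ext (LinearMap.ext fun x =>
        Subtype.ext ?_))
      exact (limMap_toLim η.hom a x).symm

variable {F} {F' : PolyFunctor n}

/-- The map on values induced by a morphism of the direct limits. -/
def valMap (ψ : limPoly F ⟶ limPoly F') (a : Fin n → ℕ) :
    stdVal F.obj a →ₗ[ℂ] stdVal F'.obj a :=
  (invEquiv F' a).symm.toLinearMap ∘ₗ (((invFunctor n).map ψ).app a).hom ∘ₗ
    (invEquiv F a).toLinearMap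

theorem toLim_valMap (ψ : limPoly F ⟶ limPoly F') (a : Fin n → ℕ) (x : stdVal F.obj a) :
    toLim F'.obj a (valMap ψ a x) = ψ.hom.hom (toLim F.obj a x) :=
  congrArg Subtype.val ((invEquiv F' a).apply_symm_apply
    ((((invFunctor n).map ψ).app a).hom (invEquiv F a x)))

/-- A `𝐆`-equivariant map commutes with the whole monoid of endomorphisms, in particular with
extensions of non-invertible `f`. -/
theorem valMap_natural (ψ : limPoly F ⟶ limPoly F') {a b : Fin n → ℕ}
    (f : stdFlag a ⟶ stdFlag b) (x : stdVal F.obj a) :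
    valMap ψ b (mapLin F.obj f x) = mapLin F'.obj f (valMap ψ a x) := by
  refine toLim_injective F'.obj b ?_
  rw [toLim_valMap, ← endAction_extend_toLim, ← endAction_extend_toLim]
  exact (endAction_natural ψ (extend f) _).trans (congrArg _ (toLim_valMap ψ a x).symm)

end PolyValues

/-! ### `Φ` is fully faithful -/

instance (n : ℕ) : (Phi n isPolyRep_lim).Faithful where
  map_injective {F F'} η θ h := by
    refine ObjectProperty.hom_ext _ (natTrans_ext_std fun j x => limOf_injective _ j ?_)
    rw [← limMap_of, ← limMap_of]
    exact congrArg (fun f => f.hom.hom (limOf F.obj j x)) h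

instance (n : ℕ) : (Phi n isPolyRep_lim).Full where
  map_surjective {F F'} ψ := by
    -- The retracts are chosen arbitrarily, flag by flag; naturality on standard flags makes the
    -- resulting family natural all the same.
    choose d s r hsr using fun U : FlagCat n => exists_retract U
    let η : F.obj ⟶ F'.obj :=
      { app := fun U => ObjectProperty.homMk (ModuleCat.ofHom
          (mapLin F'.obj (r U) ∘ₗ valMap ψ (cst n (d U)) ∘ₗ mapLin F.obj (s U)))
        naturality := fun U V f => by
          refine ObjectProperty.hom_ext _ (ModuleCat.hom_ext (LinearMap.ext fun x => ?_))
          change mapLin F'.obj (r V) (valMap ψ _ (mapLin F.obj (s V) (mapLin F.obj f x))) =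
            mapLin F'.obj f (mapLin F'.obj (r U) (valMap ψ _ (mapLin F.obj (s U) x)))
          -- Inserting `s U ≫ r U = 𝟙 U` produces a morphism between standard flags, to which
          -- `valMap_natural` applies.
          have h1 : f ≫ s V = s U ≫ (r U ≫ f ≫ s V) := by
            rw [← Category.assoc, hsr, Category.id_comp]
          rw [mapLin_comp, h1, ← mapLin_comp, valMap_natural, mapLin_comp, mapLin_comp]
          simp only [Category.assoc, hsr, Category.comp_id] }
    refine ⟨ObjectProperty.homMk η, ObjectProperty.hom_ext _ (lim_hom_ext fun j x => ?_)⟩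
    refine (limMap_of η j x).trans ?_
    change limOf F'.obj j (mapLin F'.obj (r _) (valMap ψ _ (mapLin F.obj (s _) x))) = _
    -- At a standard flag the retraction is itself a morphism of standard flags, so it moves past
    -- `valMap` and cancels against the section.
    rw [← valMap_natural, mapLin_comp, hsr, mapLin_id, ← toLim_cst, toLim_valMap, toLim_cst]
    rfl

/-! ### Every polynomial representation is a direct limit -/

section SubQuot

variable {n : ℕ} (P : FlagFunctor n)

/-- The vectors of `P(U)` all of whose images in the direct limit lie in `W`. -/
def subVal (W : Submodule ℂ (LimSpace P)) (U : FlagCat n) : Submodule ℂ (P.obj U).obj :=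
  ⨅ (j : ℕ) (f : U ⟶ stdFlag (cst n j)), W.comap (limOf P j ∘ₗ mapLin P f)

theorem mem_subVal {W : Submodule ℂ (LimSpace P)} {U : FlagCat n} {x : (P.obj U).obj} :
    x ∈ subVal P W U ↔ ∀ (j : ℕ) (f : U ⟶ stdFlag (cst n j)), limOf P j (mapLin P f x) ∈ W := by
  simp only [subVal, Submodule.mem_iInf]
  rfl

theorem mapLin_mem_subVal (W : Submodule ℂ (LimSpace P)) {U V : FlagCat n} (f : U ⟶ V) :
    ∀ x ∈ subVal P W U, mapLin P f x ∈ subVal P W V := by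
  intro x hx
  rw [mem_subVal] at hx ⊢
  intro j g
  rw [mapLin_comp]
  exact hx j _

/-- The subfunctor of `P` defined by a subspace of the direct limit. -/
def subFunctor (W : Submodule ℂ (LimSpace P)) : FlagFunctor n where
  obj U := FGModuleCat.of ℂ (subVal P W U)
  map f := FGModuleCat.ofHom ((mapLin P f).restrict (mapLin_mem_subVal P W f))
  map_id U := ObjectProperty.hom_ext _ (ModuleCat.hom_ext (LinearMap.ext fun x =>
    Subtype.ext (mapLin_id P U x.1)))
  map_comp f g := ObjectProperty.hom_ext _ (ModuleCat.hom_ext (LinearMap.ext fun x =>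
    Subtype.ext (mapLin_comp P f g x.1).symm))

/-- The inclusion of the subfunctor. -/
def subFunctorι (W : Submodule ℂ (LimSpace P)) : subFunctor P W ⟶ P where
  app U := FGModuleCat.ofHom (subVal P W U).subtype
  naturality _ _ _ := rfl

instance (W : Submodule ℂ (LimSpace P)) : Mono (subFunctorι P W) :=
  (NatTrans.mono_iff_mono_app _).2 fun U => (fg_mono_iff _).2 (subVal P W U).subtype_injective

/-- The quotient of the subfunctor defined by `W` by the part defined by `K`. -/
def quotFunctor (W K : Submodule ℂ (LimSpace P)) : FlagFunctor n where
  obj U := FGModuleCat.of ℂ (subVal P W U ⧸ (subVal P K U).comap (subVal P W U).subtype)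
  map f := FGModuleCat.ofHom (Submodule.mapQ _ _
    ((mapLin P f).restrict (mapLin_mem_subVal P W f)) fun _ hx => mapLin_mem_subVal P K f _ hx)
  map_id _ := ObjectProperty.hom_ext _ (ModuleCat.hom_ext (Submodule.linearMap_qext _
    (LinearMap.ext fun x => congrArg (Submodule.mkQ _) (Subtype.ext (mapLin_id P _ x.1)))))
  map_comp f g := ObjectProperty.hom_ext _ (ModuleCat.hom_ext (Submodule.linearMap_qext _
    (LinearMap.ext fun x => congrArg (Submodule.mkQ _)
      (Subtype.ext (mapLin_comp P f g x.1).symm))))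

/-- The projection to the quotient functor. -/
def quotFunctorπ (W K : Submodule ℂ (LimSpace P)) : subFunctor P W ⟶ quotFunctor P W K where
  app _ := FGModuleCat.ofHom (Submodule.mkQ _)
  naturality _ _ _ := rfl

instance (W K : Submodule ℂ (LimSpace P)) : Epi (quotFunctorπ P W K) :=
  (NatTrans.epi_iff_epi_app _).2 fun _ => (fg_epi_iff _).2 (Submodule.mkQ_surjective _)

end SubQuot

/-- On a standard flag the identity is the only test morphism needed: any other acts on the limit
through an element of the monoid, which preserves `W`. -/
theorem mem_subVal_std {n : ℕ} (P : PolyFunctor n) {W : Submodule ℂ (LimSpace P.obj)}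
    (hW : ∀ A : flagEnd n, ∀ z ∈ W, endAction (limPoly P) A z ∈ W) (j : ℕ)
    (x : stdVal P.obj (cst n j)) : x ∈ subVal P.obj W (stdFlag (cst n j)) ↔ limOf P.obj j x ∈ W := by
  rw [mem_subVal]
  refine ⟨fun h => ?_, fun h k f => ?_⟩
  · have := h j (𝟙 _)
    rwa [mapLin_id] at this
  · have := hW (extend f) _ h
    rwa [← toLim_cst, endAction_extend_toLim, toLim_cst] at this

section RepLemmas

variable {n : ℕ} {X Y Z : Rep.{0} ℂ (G n)}

/-- The lift is built from a linear left inverse of `m`, which need not be equivariant; the lift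
itself is, because `m` is injective and equivariant. -/
theorem exists_lift_of_injective (m : Y ⟶ Z) (i : X ⟶ Z) (hm : Function.Injective m.hom)
    (h : ∀ x, ∃ y, m.hom y = i.hom x) : ∃ f : X ⟶ Y, ∀ x, m.hom (f.hom x) = i.hom x := by
  obtain ⟨r, hr⟩ := LinearMap.exists_leftInverse_of_injective m.hom.toLinearMap
    (LinearMap.ker_eq_bot.2 hm)
  have key : ∀ x, m.hom (r (i.hom x)) = i.hom x := fun x => by
    obtain ⟨y, hy⟩ := h x
    rw [← hy]
    exact congrArg m.hom (LinearMap.congr_fun hr y)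
  refine ⟨Rep.ofHom ⟨r ∘ₗ i.hom.toLinearMap, fun g => LinearMap.ext fun x => hm ?_⟩, key⟩
  change m.hom (r (i.hom (X.ρ g x))) = m.hom (Y.ρ g (r (i.hom x)))
  rw [key, Rep.hom_comm_apply, Rep.hom_comm_apply, key]

/-- Two quotients of `X` with the same kernel are isomorphic. The map uses a linear section of `p`;
the choice disappears after applying `u`, which gives equivariance. -/
theorem nonempty_iso_of_ker (p : X ⟶ Y) (u : X ⟶ Z) (hp : Function.Surjective p.hom)
    (hu : Function.Surjective u.hom) (h : ∀ x, p.hom x = 0 ↔ u.hom x = 0) : Nonempty (Y ≅ Z) := by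
  obtain ⟨r, hr⟩ := LinearMap.exists_rightInverse_of_surjective p.hom.toLinearMap
    (LinearMap.range_eq_top.2 hp)
  have hr' : ∀ y, p.hom (r y) = y := LinearMap.congr_fun hr
  have key : ∀ x, u.hom (r (p.hom x)) = u.hom x := fun x => by
    rw [← sub_eq_zero, ← map_sub, ← h, map_sub, hr', sub_self]
  let f : Y ⟶ Z := Rep.ofHom ⟨u.hom.toLinearMap ∘ₗ r, fun g => LinearMap.ext fun y => by
    obtain ⟨x, rfl⟩ := hp y
    change u.hom (r (Y.ρ g (p.hom x))) = Z.ρ g (u.hom (r (p.hom x)))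
    rw [← Rep.hom_comm_apply, key, key, Rep.hom_comm_apply]⟩
  have : IsIso f := rep_isIso_of_bijective f
    ⟨(injective_iff_map_eq_zero f.hom.toLinearMap).2 fun y hy => by
      rw [← hr' y]; exact (h _).2 hy, fun z => by
      obtain ⟨x, rfl⟩ := hu z
      exact ⟨p.hom x, key x⟩⟩
  exact ⟨asIso f⟩

end RepLemmas

/-- Write `V` as a quotient of `Z ⊆ Φ(P)`, with `P` a sum of tensor powers. The images `W` of `Z`
and `K` of the kernel of `Z → V` are stable under the monoid because morphisms of polynomial
representations are equivariant for it. They define subfunctors of `P`, and the subquotient they cut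
out has limit `V`. -/
instance (n : ℕ) : (Phi n isPolyRep_lim).EssSurj where
  mem_essImage V := by
    obtain ⟨k, a, Z, i, q, hi, hq⟩ := V.property
    let P : PolyFunctor n := ⟨⨁ fun i => tensorPow (flagForget n) (a i),
      k, a, _, 𝟙 _, 𝟙 _, inferInstance, inferInstance⟩
    let e : (limFunctor n).obj P.obj ≅ ⨁ fun i => tensorPow (stdRep n) (a i) := limSum a
    let Z' : PolyRep n := ⟨Z, k, a, Z, i, 𝟙 _, hi, inferInstance⟩
    let i' : Z' ⟶ limPoly P := ObjectProperty.homMk (i ≫ e.inv)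
    let q' : Z' ⟶ V := ObjectProperty.homMk q
    have hi' : Function.Injective i'.hom.hom :=
      (Rep.mono_iff_injective _).1 (inferInstanceAs (Mono (i ≫ e.inv)))
    let W : Submodule ℂ (LimSpace P.obj) := LinearMap.range i'.hom.hom.toLinearMap
    let K : Submodule ℂ (LimSpace P.obj) :=
      (LinearMap.ker q'.hom.hom.toLinearMap).map i'.hom.hom.toLinearMap
    have hW : ∀ A : flagEnd n, ∀ z ∈ W, endAction (limPoly P) A z ∈ W := by
      rintro A _ ⟨z, rfl⟩
      exact ⟨endAction Z' A z, endAction_natural i' A z⟩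
    have hK : ∀ A : flagEnd n, ∀ z ∈ K, endAction (limPoly P) A z ∈ K := by
      rintro A _ ⟨z, hz, rfl⟩
      refine ⟨endAction Z' A z, ?_, endAction_natural i' A z⟩
      have hz' : q'.hom.hom z = 0 := hz
      refine LinearMap.mem_ker.2 ((endAction_natural q' A z).trans ?_)
      rw [hz', map_zero]
    let F : PolyFunctor n := ⟨quotFunctor P.obj W K, k, a, subFunctor P.obj W,
      subFunctorι P.obj W, quotFunctorπ P.obj W K, inferInstance, inferInstance⟩
    have hm : Function.Injective (limMap (subFunctorι P.obj W)) :=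
      (Rep.mono_iff_injective _).1 (limFunctor_map_mono (subFunctorι P.obj W))
    -- The limit of the subfunctor embeds in `Φ(P)` with image `W`, so `Z` maps onto it.
    obtain ⟨f, hf⟩ := exists_lift_of_injective ((limFunctor n).map (subFunctorι P.obj W)) i'.hom hm
      (by
        intro z
        obtain ⟨j, x, hx⟩ := exists_limOf P.obj (i'.hom.hom z)
        have hxW : x ∈ subVal P.obj W (stdFlag (cst n j)) :=
          (mem_subVal_std P hW j x).2 ⟨z, hx.symm⟩
        exact ⟨limOf (subFunctor P.obj W) j (⟨x, hxW⟩ : subVal P.obj W (stdFlag (cst n j))),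
          (limMap_of (subFunctorι P.obj W) j _).trans hx⟩)
    have hfs : Function.Surjective f.hom := by
      intro y
      obtain ⟨j, x, rfl⟩ := exists_limOf (subFunctor P.obj W) y
      change subVal P.obj W (stdFlag (cst n j)) at x
      obtain ⟨z, hz⟩ := (mem_subVal_std P hW j x.1).1 x.2
      exact ⟨z, hm ((hf z).trans (hz.trans (limMap_of (subFunctorι P.obj W) j x).symm))⟩
    -- Both `V` and the limit of the quotient functor are quotients of `Z`. Their kernels are
    -- compared at one level, where being zero in the quotient means lying in the part defined by
    -- `K`.
    obtain ⟨iso⟩ := nonempty_iso_of_ker (f ≫ (limFunctor n).map (quotFunctorπ P.obj W K)) q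
      (((Rep.epi_iff_surjective _).1 (limFunctor_map_epi (quotFunctorπ P.obj W K))).comp hfs)
      ((Rep.epi_iff_surjective q).1 hq) fun z => by
        obtain ⟨j, x, hx⟩ := exists_limOf (subFunctor P.obj W) (f.hom z)
        change subVal P.obj W (stdFlag (cst n j)) at x
        have h1 : limOf P.obj j x.1 = i'.hom.hom z :=
          (limMap_of (subFunctorι P.obj W) j x).symm.trans
            ((congrArg (limMap (subFunctorι P.obj W)) hx).trans (hf z))
        have h2 : limMap (quotFunctorπ P.obj W K) (f.hom z) =
            limOf (quotFunctor P.obj W K) j (Submodule.mkQ _ x) :=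
          (congrArg (limMap (quotFunctorπ P.obj W K)) hx.symm).trans
            (limMap_of (quotFunctorπ P.obj W K) j x)
        have h3 : x.1 ∈ subVal P.obj K (stdFlag (cst n j)) ↔ q.hom z = 0 := by
          rw [mem_subVal_std P hK, h1]
          constructor
          · rintro ⟨z', hz', h⟩
            rw [← hi' h]
            exact hz'
          · exact fun h => ⟨z, h, rfl⟩
        change limMap (quotFunctorπ P.obj W K) (f.hom z) = 0 ↔ _
        rw [h2, ← h3]
        refine (map_eq_zero_iff _ (limOf_injective (quotFunctor P.obj W K) j)).trans ?_
        exact Submodule.Quotient.mk_eq_zero _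
    exact ⟨F, ⟨(isPolyRep n).isoMk iso⟩⟩

instance (n : ℕ) : (Phi n isPolyRep_lim).IsEquivalence where

/-! ### The monoidal structures -/

section General

open Functor.LaxMonoidal Functor.OplaxMonoidal

variable {C D : Type*} [Category C] [Category D] [MonoidalCategory C] [MonoidalCategory D]

/-- The lift of a monoidal functor to a full monoidal subcategory is monoidal. -/
abbrev liftMonoidal (P : ObjectProperty D) [P.IsMonoidal] (K : C ⥤ D) [K.Monoidal]
    (h : ∀ X, P (K.obj X)) : (P.lift K h).Monoidal where
  ε := ObjectProperty.homMk (ε K)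
  μ X Y := ObjectProperty.homMk (μ K X Y)
  μ_natural_left f X := P.ι.map_injective (μ_natural_left K f X)
  μ_natural_right X f := P.ι.map_injective (μ_natural_right K X f)
  associativity X Y Z := P.ι.map_injective (Functor.LaxMonoidal.associativity K X Y Z)
  left_unitality X := P.ι.map_injective (Functor.LaxMonoidal.left_unitality K X)
  right_unitality X := P.ι.map_injective (Functor.LaxMonoidal.right_unitality K X)
  η := ObjectProperty.homMk (η K)
  δ X Y := ObjectProperty.homMk (δ K X Y)
  δ_natural_left f X := P.ι.map_injective (δ_natural_left K f X)
  δ_natural_right X f := P.ι.map_injective (δ_natural_right K X f)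
  oplax_associativity X Y Z := P.ι.map_injective (oplax_associativity K X Y Z)
  oplax_left_unitality X := P.ι.map_injective (oplax_left_unitality K X)
  oplax_right_unitality X := P.ι.map_injective (oplax_right_unitality K X)
  ε_η := P.ι.map_injective (Functor.Monoidal.ε_η K)
  η_ε := P.ι.map_injective (Functor.Monoidal.η_ε K)
  μ_δ X Y := P.ι.map_injective (Functor.Monoidal.μ_δ K X Y)
  δ_μ X Y := P.ι.map_injective (Functor.Monoidal.δ_μ K X Y)

/-- The monoidal structure on the inverse is by construction the mate of the one on the functor. -/
theorem inverse_isMonoidal (e : C ≌ D) [e.functor.Monoidal] :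
    letI := e.inverseMonoidal
    e.toAdjunction.IsMonoidal :=
  letI := e.inverseMonoidal
  { leftAdjoint_ε := rfl
    leftAdjoint_μ := fun _ _ => rfl }

variable [BraidedCategory C] [BraidedCategory D]

/-- The lift of a braided functor to a full monoidal subcategory is braided. -/
abbrev liftBraided (P : ObjectProperty D) [P.IsMonoidal] (K : C ⥤ D) [K.Braided]
    (h : ∀ X, P (K.obj X)) : (P.lift K h).Braided where
  toMonoidal := liftMonoidal P K h
  braided X Y := P.ι.map_injective (Functor.LaxBraided.braided (F := K) X Y)

/-- The right adjoint of a braided functor respects the braiding. -/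
theorem rightAdjoint_braided {L : C ⥤ D} {R : D ⥤ C} (adj : L ⊣ R) [L.Braided] [R.LaxMonoidal]
    [adj.IsMonoidal] (X Y : D) :
    μ R X Y ≫ R.map (β_ X Y).hom = (β_ (R.obj X) (R.obj Y)).hom ≫ μ R Y X := by
  -- After transposition both sides consist of `δ`, the two counits and the braiding, and differ
  -- only by the naturality of the braiding.
  refine (adj.homEquiv _ _).symm.injective ?_
  have hb : L.map (β_ (R.obj X) (R.obj Y)).hom ≫ δ L (R.obj Y) (R.obj X) =
      δ L (R.obj X) (R.obj Y) ≫ (β_ (L.obj (R.obj X)) (L.obj (R.obj Y))).hom := by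
    rw [L.map_braiding]
    simp
  rw [Adjunction.homEquiv_counit, Adjunction.homEquiv_counit, Functor.map_comp, Functor.map_comp,
    Category.assoc, Category.assoc, Adjunction.counit_naturality,
    Adjunction.map_μ_comp_counit_app_tensor, reassoc_of% Adjunction.map_μ_comp_counit_app_tensor,
    reassoc_of% hb]
  congr 1
  exact BraidedCategory.braiding_naturality _ _

/-- The inverse of a braided equivalence is braided. -/
abbrev inverseBraided (e : C ≌ D) [e.functor.Braided] : e.inverse.Braided where
  toMonoidal := e.inverseMonoidal
  braided := by
    let := e.inverseMonoidal
    have := inverse_isMonoidal e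
    exact rightAdjoint_braided e.toAdjunction

end General

/-! ### The canonical tensor structures on `Φ` and its inverse -/

instance (n : ℕ) : (Phi n isPolyRep_lim).Braided :=
  liftBraided (isPolyRep n) ((isPolyFunctor n).ι ⋙ limFunctor n) isPolyRep_lim

instance (n : ℕ) : (Phi n isPolyRep_lim).Additive where
  map_add {_ _ f g} := (isPolyRep n).ι.map_injective ((limFunctor n).map_add (f := f.hom) (g := g.hom))

instance (n : ℕ) : (Phi n isPolyRep_lim).Linear ℂ where
  map_smul f c := (isPolyRep n).ι.map_injective ((limFunctor n).map_smul c f.hom)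

section Compare

variable {n : ℕ}

/-- The inclusion of the full subcategory contributes a tensorator that is an identity, which has to
be stripped off. -/
theorem Phi_mu (F F' : PolyFunctor n) :
    (Functor.LaxMonoidal.μ (Phi n isPolyRep_lim) F F').hom =
      Functor.LaxMonoidal.μ (limFunctor n) F.obj F'.obj := by
  change Functor.LaxMonoidal.μ (limFunctor n) F.obj F'.obj ≫ (limFunctor n).map (𝟙 _) = _
  rw [CategoryTheory.Functor.map_id, Category.comp_id]

theorem Phi_epsilon : (Functor.LaxMonoidal.ε (Phi n isPolyRep_lim)).hom =
    Functor.LaxMonoidal.ε (limFunctor n) := by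
  change Functor.LaxMonoidal.ε (limFunctor n) ≫ (limFunctor n).map (𝟙 _) = _
  rw [CategoryTheory.Functor.map_id, Category.comp_id]

theorem Phi_delta (F F' : PolyFunctor n) :
    (Functor.OplaxMonoidal.δ (Phi n isPolyRep_lim) F F').hom = limDelta F.obj F'.obj := by
  change (limFunctor n).map (𝟙 _) ≫ limDelta F.obj F'.obj = _
  rw [CategoryTheory.Functor.map_id, Category.id_comp]

theorem Phi_eta : (Functor.OplaxMonoidal.η (Phi n isPolyRep_lim)).hom = limEta n := by
  change (limFunctor n).map (𝟙 _) ≫ limEta n = _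
  rw [CategoryTheory.Functor.map_id, Category.id_comp]

theorem limDeltaLin_toLim (F F' : FlagFunctor n) (a : Fin n → ℕ) (x : stdVal F a)
    (y : stdVal F' a) : limDeltaLin F F' (toLim (F ⊗ F') a (valTmul x y)) =
      TensorProduct.tmul ℂ (toLim F a x) (toLim F' a y) :=
  limDeltaLin_tmul F F' _ (mapLin F (stdIncl (le_cst_sup a)) x)
    (mapLin F' (stdIncl (le_cst_sup a)) y)

/-- The equivalence between polynomial functors and polynomial representations. -/
def PhiEquiv (n : ℕ) : PolyFunctor n ≌ PolyRep n := (Phi n isPolyRep_lim).asEquivalence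

instance : (PhiEquiv n).functor.Braided := inferInstanceAs (Phi n isPolyRep_lim).Braided

instance : (PhiEquiv n).inverse.Braided := inverseBraided (PhiEquiv n)

/-- The adjunction between `Φ` and its inverse. -/
def PhiAdj (n : ℕ) : Phi n isPolyRep_lim ⊣ (PhiEquiv n).inverse := (PhiEquiv n).toAdjunction

instance : (PhiAdj n).IsMonoidal :=
  inverse_isMonoidal (PhiEquiv n)

/-- The inverse of `Φ` sends a representation `V` to `ℂ^a ↦ V^{H_a}`. -/
def PsiIso (n : ℕ) : (PhiEquiv n).inverse ⋙ restrictStd n ≅ invFunctor n :=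
  Functor.isoWhiskerLeft (PhiEquiv n).inverse (invIso n) ≪≫
    (Functor.associator _ _ _).symm ≪≫
    Functor.isoWhiskerRight (PhiEquiv n).counitIso (invFunctor n) ≪≫ Functor.leftUnitor _

/-- `PsiIso` is `invIso` followed by the counit on invariants, so this holds by construction; it
says that the counit is induced by the inclusions of the invariants. -/
theorem fromPsi_eq (V : PolyRep n) (a : Fin n → ℕ)
    (x : (((PhiEquiv n).inverse.obj V).obj.obj (stdFlag a)).obj) :
    fromPsi (PsiIso n) V a x =
      ((PhiAdj n).counit.app V).hom.hom (toLim ((PhiEquiv n).inverse.obj V).obj a x) :=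
  rfl

/-- Applying `Φ` to the tensorator of the inverse and then the counit gives `δ` followed by the two
counits. Evaluated on a pure tensor of values, where `δ` is explicit, this is the canonical
structure. -/
theorem fromPsi_mu (V W : PolyRep n) (a : Fin n → ℕ)
    (x : (((PhiEquiv n).inverse.obj V).obj.obj (stdFlag a)).obj)
    (y : (((PhiEquiv n).inverse.obj W).obj.obj (stdFlag a)).obj) :
    fromPsi (PsiIso n) (V ⊗ W) a
      (((Functor.LaxMonoidal.μ (PhiEquiv n).inverse V W).hom.app (stdFlag a)).hom.hom
        (TensorProduct.tmul ℂ x y)) =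
      TensorProduct.tmul ℂ (fromPsi (PsiIso n) V a x) (fromPsi (PsiIso n) W a y) := by
  have h := congrArg (fun f => f.hom.hom (toLim (((PhiEquiv n).inverse.obj V).obj ⊗
    ((PhiEquiv n).inverse.obj W).obj) a (valTmul x y)))
    (Adjunction.map_μ_comp_counit_app_tensor (PhiAdj n) V W)
  refine (fromPsi_eq _ _ _).trans (Eq.trans (congrArg _ (limMap_toLim
    (Functor.LaxMonoidal.μ (PhiEquiv n).inverse V W).hom a (valTmul x y)).symm) (h.trans ?_))
  change TensorProduct.map ((PhiAdj n).counit.app V).hom.hom.toLinearMap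
    ((PhiAdj n).counit.app W).hom.hom.toLinearMap
    ((Functor.OplaxMonoidal.δ (Phi n isPolyRep_lim) _ _).hom.hom _) = _
  rw [Phi_delta]
  exact (congrArg _ (limDeltaLin_toLim _ _ a x y)).trans (TensorProduct.map_tmul _ _ _ _)

theorem fromPsi_epsilon (a : Fin n → ℕ) :
    fromPsi (PsiIso n) (𝟙_ (PolyRep n)) a
      (((Functor.LaxMonoidal.ε (PhiEquiv n).inverse).hom.app (stdFlag a)).hom.hom (1 : ℂ)) =
      (1 : ℂ) := by
  have h := congrArg (fun f => f.hom.hom (toLim (𝟙_ (FlagFunctor n)) a (1 : ℂ)))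
    (Adjunction.map_ε_comp_counit_app_unit (PhiAdj n))
  refine (fromPsi_eq _ _ _).trans (Eq.trans (congrArg _ (limMap_toLim
    (Functor.LaxMonoidal.ε (PhiEquiv n).inverse).hom a (1 : ℂ)).symm) (h.trans ?_))
  change (Functor.OplaxMonoidal.η (Phi n isPolyRep_lim)).hom.hom _ = _
  rw [Phi_eta]
  exact limEta_of _ 1

end Compare

end

end FlagSchur

/-! ### The proposition -/

theorem mainTheorem3 (n : ℕ) (hn : 1 ≤ n) :
    ∃ (h : ∀ F : PolyFunctor n, isPolyRep n ((limFunctor n).obj F.obj))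
      (Ψ : PolyRep n ⥤ PolyFunctor n) (θ : Ψ ⋙ restrictStd n ≅ invFunctor n)
      (_ : (Phi n h).Braided) (_ : Ψ.Braided) (adj : Phi n h ⊣ Ψ),
      ((Phi n h).Additive ∧ (Phi n h).Linear ℂ) ∧ (Ψ.Additive ∧ Ψ.Linear ℂ) ∧
      adj.IsMonoidal ∧ (∀ F, IsIso (adj.unit.app F)) ∧ (∀ V, IsIso (adj.counit.app V)) ∧
      (∀ (V : PolyRep n) (j : ℕ) (x : ((Ψ.obj V).obj.obj (stdFlag (cst n j))).obj),
        (adj.counit.app V).hom.hom (toPhi h (Ψ.obj V) j x) = fromPsi θ V (cst n j) x) ∧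
      (∀ (F F' : PolyFunctor n) (j : ℕ) (x : (F.obj.obj (stdFlag (cst n j))).obj)
        (y : (F'.obj.obj (stdFlag (cst n j))).obj),
        (Functor.LaxMonoidal.μ (Phi n h) F F').hom.hom
            (TensorProduct.tmul ℂ (toPhi h F j x) (toPhi h F' j y)) =
          toPhi h (F ⊗ F') j (TensorProduct.tmul ℂ x y)) ∧
      (∀ j : ℕ, (Functor.LaxMonoidal.ε (Phi n h)).hom.hom (1 : ℂ) = toPhi h (𝟙_ (PolyFunctor n)) j (1 : ℂ)) ∧
      (∀ (V W : PolyRep n) (a : Fin n → ℕ) (x : ((Ψ.obj V).obj.obj (stdFlag a)).obj)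
        (y : ((Ψ.obj W).obj.obj (stdFlag a)).obj),
        fromPsi θ (V ⊗ W) a (((Functor.LaxMonoidal.μ Ψ V W).hom.app (stdFlag a)).hom.hom
            (TensorProduct.tmul ℂ x y)) =
          TensorProduct.tmul ℂ (fromPsi θ V a x) (fromPsi θ W a y)) ∧
      (∀ a : Fin n → ℕ,
        fromPsi θ (𝟙_ (PolyRep n)) a (((Functor.LaxMonoidal.ε Ψ).hom.app (stdFlag a)).hom.hom (1 : ℂ)) = (1 : ℂ)) := by
  -- Additivity and linearity are stated for the functor of the equivalence, from which its inverse
  -- inherits them.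
  have : (PhiEquiv n).functor.Additive := inferInstanceAs (Phi n isPolyRep_lim).Additive
  have : (PhiEquiv n).functor.Linear ℂ := inferInstanceAs ((Phi n isPolyRep_lim).Linear ℂ)
  refine ⟨isPolyRep_lim, (PhiEquiv n).inverse, PsiIso n, inferInstance, inferInstance, PhiAdj n,
    ⟨inferInstance, inferInstance⟩, ⟨inferInstance, inferInstance⟩, inferInstance,
    fun F => inferInstanceAs (IsIso ((PhiEquiv n).unitIso.hom.app F)),
    fun V => inferInstanceAs (IsIso ((PhiEquiv n).counitIso.hom.app V)),
    fun V j x => ?_, fun F F' j x y => ?_, fun j => ?_, fromPsi_mu, fromPsi_epsilon⟩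
  · rw [fromPsi_eq, toLim_cst]
    rfl
  · rw [Phi_mu]
    exact lim_mu_tmul F.obj F'.obj j x y
  · rw [Phi_epsilon]
    exact lim_epsilon j
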